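/- Let $n\ge 2$, let $1<\rho<n$, let $\alpha,\beta$ be real numbers with $\frac{\rho n}{\rho n+\rho-n}\le\alpha$ and $1<\alpha<\beta<n$, let $\alpha<p<+\infty$, and put $q=\frac{p}{1-\alpha/\beta}$. Let $w$ be a weight of the Muckenhoupt class $A_{p/\alpha}$ on $\mathbb{R}^n$, i.e. $w$ is locally integrable, $w>0$ almost everywhere, and, with $s=p/\alpha$, $$[w]_{A_s}=\sup_{B}\Big(\frac1{|B|}\int_B w\,dx\Big)\Big(\frac1{|B|}\int_B w^{-\frac1{s-1}}dx\Big)^{s-1}<+\infty,$$ the supremum being over all balls $B\subset\mathbb{R}^n$. Then there is a finite constant $C$, depending only on $n,\rho,\alpha,\beta,p$ and $w$, such that the following holds. Let $\Omega\in L^1(\mathbb{S}^{n-1})\cap L^\rho(\mathbb{S}^{n-1})$ be real-valued with $\int_{\mathbb{S}^{n-1}}\Omega\,d\sigma=0$, and let $f:\mathbb{R}^n\to\mathbb{R}$ be locally integrable with a locally integrable weak gradient $\nabla f$ such that $\nabla f\in L^p(w)=L^p(\mathbb{R}^n,w\,dx)$ and $$\|\nabla f\|_{\dot{\mathcal M}^{\alpha,\frac{\alpha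 n}{\beta}}}=\sup_{x\in\mathbb{R}^n,\,r>0}\Big(\frac1{r^{\,n-\beta}}\int_{B(x,r)}|\nabla f(y)|^\alpha dy\Big)^{\frac1\alpha}<+\infty .$$ Then the principal value $$T_\Omega f(x)=\mathrm{p.v.}\int_{\mathbb{R}^n}\frac{\Omega(y/|y|)}{|y|^n}f(x-y)\,dy=\lim_{\varepsilon\to0^+,\ R\to+\infty}\int_{\varepsilon<|y|<R}\frac{\Omega(y/|y|)}{|y|^n}f(x-y)\,dy$$ exists for almost every $x\in\mathbb{R}^n$ (with absolutely convergent truncated integrals), $T_\Omega f\in L^q(w)$, and $$\|T_\Omega f\|_{L^q(w)}\le C\,\|\Omega\|_{L^\rho(\mathbb{S}^{n-1})}\,\|\nabla f\|_{\dot{\mathcal M}^{\alpha,\frac{\alpha n}{\beta}}}^{\frac{\alpha}{\beta}}\,\|\nabla f\|_{L^p(w)}^{1-\frac{\alpha}{\beta}} .$$ -/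

import Mathlib

open MeasureTheory Filter Topology Set
open scoped ENNReal NNReal ContDiff

namespace RoughSingular

/-- Euclidean space `ℝⁿ`. -/
abbrev Rn (n : ℕ) : Type := EuclideanSpace ℝ (Fin n)

/-- The unit sphere of `ℝⁿ`. -/
abbrev UnitSphere (n : ℕ) : Type := Metric.sphere (0 : Rn n) 1

/-- Surface measure on the unit sphere: `σ(A) = n · |{r θ : 0 < r < 1, θ ∈ A}|`. -/
noncomputable abbrev surfaceMeasure (n : ℕ) : Measure (UnitSphere n) :=
  (volume : Measure (Rn n)).toSphere

/-- The normalisation `y / |y|` of a nonzero vector, as a point of the unit sphere. -/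
noncomputable def direction {n : ℕ} (y : Rn n) (hy : y ≠ 0) : UnitSphere n :=
  ⟨‖y‖⁻¹ • y, by
    rw [mem_sphere_zero_iff_norm, norm_smul, norm_inv, norm_norm]
    exact inv_mul_cancel₀ (norm_ne_zero_iff.mpr hy)⟩

open Classical in
/-- The rough homogeneous kernel `Ω(y / |y|) / |y|ⁿ` (with the irrelevant value `0` at `y = 0`). -/
noncomputable def roughKernel {n : ℕ} (Ω : UnitSphere n → ℝ) (y : Rn n) : ℝ :=
  if hy : y = 0 then 0 else Ω (direction y hy) / ‖y‖ ^ n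

/-- The truncated integral of `Ω(y / |y|) / |y|ⁿ · f(x - y)` over `ε < |y| < R`. -/
noncomputable def truncatedRough {n : ℕ} (Ω : UnitSphere n → ℝ) (f : Rn n → ℝ) (x : Rn n)
    (ε R : ℝ) : ℝ :=
  ∫ y in {y : Rn n | ε < ‖y‖ ∧ ‖y‖ < R}, roughKernel Ω y * f (x - y)

/-- The principal value integral at `x` exists and is equal to `L`: all truncated integrals
converge absolutely, and they tend to `L` as `ε → 0⁺` and `R → +∞`. -/
def HasPrincipalValue {n : ℕ} (Ω : UnitSphere n → ℝ) (f : Rn n → ℝ) (x : Rn n) (L : ℝ) : Prop :=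
  (∀ ε R : ℝ, 0 < ε →
    IntegrableOn (fun y : Rn n => roughKernel Ω y * f (x - y)) {y : Rn n | ε < ‖y‖ ∧ ‖y‖ < R}) ∧
  Tendsto (fun t : ℝ × ℝ => truncatedRough Ω f x t.1 t.2) (𝓝[>] (0 : ℝ) ×ˢ atTop) (𝓝 L)

/-- The rough singular integral operator
`T_Ω f (x) = p.v. ∫ Ω(y / |y|) / |y|ⁿ f(x - y) dy`. -/
noncomputable def roughSingularIntegral {n : ℕ} (Ω : UnitSphere n → ℝ) (f : Rn n → ℝ)
    (x : Rn n) : ℝ :=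
  limUnder (𝓝[>] (0 : ℝ) ×ˢ (atTop : Filter ℝ))
    (fun t : ℝ × ℝ => truncatedRough Ω f x t.1 t.2)

/-- `G` is the weak gradient of the locally integrable function `f`: both are locally integrable
and `∫ f ∂_v φ = - ∫ φ ⟨G, v⟩` for all test functions `φ ∈ C_c^∞(ℝⁿ)` and all directions `v`. -/
structure IsWeakGradient {n : ℕ} (f : Rn n → ℝ) (G : Rn n → Rn n) : Prop where
  locallyIntegrable : LocallyIntegrable f volume
  locallyIntegrable_grad : LocallyIntegrable G volume
  integral_eq : ∀ φ : Rn n → ℝ, ContDiff ℝ ∞ φ → HasCompactSupport φ → ∀ v : Rn n,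
    ∫ x, f x * fderiv ℝ φ x v = - ∫ x, φ x * inner ℝ (G x) v

/-- The homogeneous Morrey norm
`sup_{x, r > 0} (r^{-n(1 - p/q)} ∫_{B(x,r)} |F|^p)^{1/p}`. -/
noncomputable def morreyNorm {n : ℕ} {V : Type*} [NormedAddCommGroup V] (p q : ℝ)
    (F : Rn n → V) : ℝ≥0∞ :=
  ⨆ (x : Rn n) (r : ℝ) (_ : 0 < r),
    (ENNReal.ofReal (r ^ (-((n : ℝ) * (1 - p / q)))) *
      ∫⁻ y in Metric.ball x r, ‖F y‖ₑ ^ p) ^ (1 / p)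

/-- Membership in the homogeneous Morrey space (finiteness of the norm contains local
`p`-integrability). -/
def MemMorrey {n : ℕ} {V : Type*} [NormedAddCommGroup V] (p q : ℝ) (F : Rn n → V) : Prop :=
  AEStronglyMeasurable F volume ∧ morreyNorm p q F < ⊤

/-- The Muckenhoupt characteristic
`[w]_{A_s} = sup_B (⨍_B w) (⨍_B w^{-1/(s-1)})^{s-1}`, the supremum being over all balls. -/
noncomputable def muckenhouptCharacteristic {n : ℕ} (s : ℝ) (w : Rn n → ℝ) : ℝ≥0∞ :=
  ⨆ (x : Rn n) (r : ℝ) (_ : 0 < r),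
    (⨍⁻ y in Metric.ball x r, ENNReal.ofReal (w y) ∂volume) *
      (⨍⁻ y in Metric.ball x r, ENNReal.ofReal (w y) ^ (-(1 / (s - 1))) ∂volume) ^ (s - 1)

/-- The Muckenhoupt class `A_s`, `1 < s < ∞`: locally integrable, almost everywhere positive
functions with finite characteristic. -/
structure IsMuckenhouptWeight {n : ℕ} (s : ℝ) (w : Rn n → ℝ) : Prop where
  locallyIntegrable : LocallyIntegrable w volume
  pos : ∀ᵐ x, 0 < w x
  characteristic_lt_top : muckenhouptCharacteristic s w < ⊤

/-- The measure `w(x) dx`; the space `L^p(w)` is `L^p` of this measure. -/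
noncomputable def weightedMeasure {n : ℕ} (w : Rn n → ℝ) : Measure (Rn n) :=
  volume.withDensity fun x => ENNReal.ofReal (w x)

end RoughSingular

/-! The kernel is cut into the dyadic annuli `2^k ≤ |y| < 2^(k+1)`. Since `Ω` has mean zero, any
constant may be subtracted from `f` on each annulus. Hölder with exponents `ρ` and `ρ' = ρ/(ρ-1)`,
followed by Sobolev–Poincaré from `L^s` to `L^ρ'` with `s = ρn/(ρn+ρ-n) ≤ α`, bounds the `k`-th
piece by a multiple of `‖Ω‖_ρ · 2^k (⨍_{B(x, 6·2^k)} |G|^α)^(1/α)`; this is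
`exists_lintegral_annulus_le`.

The average is at most the maximal function `M` of `|G|^α` at `x`, which is good at small scales,
and at most a multiple of `2^(-kβ)` times the `α`-th power of the Morrey norm `N`, which is good at
large scales. Summing the smaller of the two bounds, as Hedberg does, gives `|T f(x)| ≲ ‖Ω‖_ρ
N^(α/β) M(x)^((1-α/β)/α)` (`tsum_setLAverage_le`). The dyadic bounds are summable wherever `M(x) <
∞`, and dominated convergence for series then yields the principal value
(`exists_hasPrincipalValue`). As `(1-α/β) q = p`, the `q`-th power of the bound contains `M^(p/α)`,
and Muckenhoupt's theorem for `A_(p/α)` closes the estimate.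

Two classical ingredients are proved on the way. Muckenhoupt's theorem follows Lerner: the
unweighted maximal function is dominated by a composition of the maximal functions of the doubling
measures `w` and `w^(-1/(s-1))`, so no reverse Hölder inequality is needed. Sobolev–Poincaré on
balls comes from Gagliardo–Nirenberg–Sobolev applied to a cutoff, and passes to weak gradients by
mollification. -/

namespace RoughSingular

/-! ### Dyadic sums in `ℝ≥0∞`. -/

section DyadicSums

/-- A geometric series dominated by its largest term, the last power of two below `a`. -/
theorem tsum_zpow_lt_rpow_le {ε : ℝ} (hε : 0 < ε) :
    ∃ C : ℝ≥0, ∀ a : ℝ≥0∞,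
      ∑' k : ℤ, (if (2 : ℝ≥0∞) ^ k < a then ((2 : ℝ≥0∞) ^ k) ^ ε else 0) ≤ C * a ^ ε := by
  set ρ : ℝ≥0∞ := ((2 : ℝ≥0∞)⁻¹) ^ ε with hρ
  have hρ1 : ρ < 1 := ENNReal.rpow_lt_one (by norm_num) hε
  have hfin : (1 - ρ)⁻¹ ≠ ⊤ := by
    rw [ENNReal.inv_ne_top]; exact (tsub_pos_of_lt hρ1).ne'
  have hfin0 : (1 - ρ)⁻¹ ≠ 0 := by
    rw [ENNReal.inv_ne_zero]; exact (lt_of_le_of_lt tsub_le_self ENNReal.one_lt_top).ne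
  refine ⟨((1 - ρ)⁻¹).toNNReal, fun a => ?_⟩
  rw [ENNReal.coe_toNNReal hfin]
  rcases eq_or_ne a 0 with rfl | ha0
  · simp
  rcases eq_or_ne a ⊤ with rfl | hat
  · rw [ENNReal.top_rpow_of_pos hε, ENNReal.mul_top hfin0]; exact le_top
  obtain ⟨m, hm1, hm2⟩ := ENNReal.exists_mem_Ioc_zpow ha0 hat (by norm_num : (1:ℝ≥0∞) < 2) (by norm_num)
  -- All nonzero terms have `k ≤ m`, so the sum is reindexed by `k = m - j` with `j : ℕ`.
  have hinj : Function.Injective (fun j : ℕ => m - (j : ℤ)) := by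
    intro i j h; simpa using h
  rw [← hinj.tsum_eq]
  · calc ∑' j : ℕ, (if (2 : ℝ≥0∞) ^ (m - (j : ℤ)) < a then ((2 : ℝ≥0∞) ^ (m - (j:ℤ))) ^ ε else 0)
        ≤ ∑' j : ℕ, a ^ ε * ρ ^ j := by
          refine ENNReal.tsum_le_tsum fun j => ?_
          split_ifs with h
          · rw [ENNReal.zpow_sub (by norm_num) (by norm_num), ENNReal.mul_rpow_of_nonneg _ _ hε.le]
            gcongr
            rw [hρ, zpow_natCast, ENNReal.inv_pow, ← ENNReal.rpow_natCast, ← ENNReal.rpow_natCast,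
              ← ENNReal.rpow_mul, ← ENNReal.rpow_mul, mul_comm]
          · exact zero_le
      _ = (1 - ρ)⁻¹ * a ^ ε := by
          rw [ENNReal.tsum_mul_left, ENNReal.tsum_geometric, mul_comm]
  · intro k hk
    rw [Function.mem_support] at hk
    have h : (2 : ℝ≥0∞) ^ k < a := by
      by_contra h; simp [h] at hk
    have hlt : k < m + 1 := by
      by_contra hcon
      push Not at hcon
      exact absurd (h.trans_le hm2) (not_lt.2 (ENNReal.zpow_le_of_le (by norm_num) hcon))
    exact ⟨(m - k).toNat, by simp only; omega⟩

/-- The last power of two strictly below `a` is at least `a / 2`, so that single term suffices; for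
`a = ⊤` every term is present and the sum diverges. -/
theorem rpow_le_tsum_zpow {p : ℝ} (hp : 0 < p) (a : ℝ≥0∞) :
    a ^ p ≤ 2 ^ p * ∑' k : ℤ, (if (2 : ℝ≥0∞) ^ k < a then ((2 : ℝ≥0∞) ^ k) ^ p else 0) := by
  rcases eq_or_ne a 0 with rfl | ha0
  · simp [hp]
  rcases eq_or_ne a ⊤ with rfl | hat
  · have h1 : ∀ k : ℤ, (2 : ℝ≥0∞) ^ k < ⊤ := fun k =>
      ENNReal.zpow_lt_top (by norm_num) (by norm_num) k
    simp only [h1, if_true]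
    have : ∑' k : ℤ, ((2 : ℝ≥0∞) ^ k) ^ p = ⊤ := by
      rw [← top_le_iff]
      calc (⊤ : ℝ≥0∞) = ∑' k : ℕ, (1 : ℝ≥0∞) := by simp
        _ ≤ ∑' k : ℕ, ((2 : ℝ≥0∞) ^ (k : ℤ)) ^ p := by
          refine ENNReal.tsum_le_tsum fun k => ?_
          refine ENNReal.one_le_rpow ?_ hp
          rw [zpow_natCast]; exact one_le_pow₀ (by norm_num)
        _ ≤ _ := ENNReal.tsum_comp_le_tsum_of_injective Nat.cast_injective _
    rw [this, ENNReal.mul_top]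
    · exact le_top
    · simp
  obtain ⟨m, hm1, hm2⟩ := ENNReal.exists_mem_Ioc_zpow ha0 hat (by norm_num : (1:ℝ≥0∞) < 2) (by norm_num)
  calc a ^ p ≤ ((2 : ℝ≥0∞) ^ (m + 1)) ^ p := by gcongr
    _ = 2 ^ p * ((2 : ℝ≥0∞) ^ m) ^ p := by
        rw [ENNReal.zpow_add (by norm_num) (by norm_num), zpow_one, mul_comm,
          ENNReal.mul_rpow_of_nonneg _ _ hp.le]
    _ ≤ _ := by
        gcongr
        refine le_trans ?_ (ENNReal.le_tsum m)
        simp [hm1]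

/-- The dyadic sum behind Hedberg's inequality. -/
theorem tsum_min_zpow_le {γ : ℝ} (hγ : 0 < γ) :
    ∃ C : ℝ≥0, ∀ A N : ℝ≥0∞, A ≠ ⊤ → N ≠ ⊤ →
      ∑' k : ℤ, min ((2 : ℝ≥0∞) ^ k * A) (((2 : ℝ≥0∞) ^ k) ^ (-γ) * N) ≤
        C * N ^ (1 / (1 + γ)) * A ^ (1 - 1 / (1 + γ)) := by
  obtain ⟨C₁, h₁⟩ := tsum_zpow_lt_rpow_le (ε := 1) one_pos
  obtain ⟨C₂, h₂⟩ := tsum_zpow_lt_rpow_le hγ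
  have hθ : 0 < 1 / (1 + γ) := by positivity
  have hθ' : 0 < 1 - 1 / (1 + γ) := by
    rw [sub_pos, div_lt_one (by positivity)]; linarith
  refine ⟨C₁ + C₂ * 2 ^ γ, fun A N hA hN => ?_⟩
  rcases eq_or_ne A 0 with rfl | hA0
  · simp
  rcases eq_or_ne N 0 with rfl | hN0
  · simp
  -- The crossover scale, where the growing bound `R * A` equals the decaying bound `R ^ (-γ) * N`.
  set R : ℝ≥0∞ := (N / A) ^ (1 / (1 + γ)) with hR
  have hNA0 : N / A ≠ 0 := by simp [hN0, hA]
  have hNAt : N / A ≠ ⊤ := ENNReal.div_ne_top hN hA0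
  have hR0 : R ≠ 0 := (ENNReal.rpow_pos (pos_iff_ne_zero.2 hNA0) hNAt).ne'
  have hRt : R ≠ ⊤ := ENNReal.rpow_ne_top_of_nonneg hθ.le hNAt
  set P := N ^ (1 / (1 + γ)) * A ^ (1 - 1 / (1 + γ)) with hP
  have hRA : R * A = P := by
    rw [hR, hP, ENNReal.div_rpow_of_nonneg _ _ hθ.le, ENNReal.rpow_sub _ _ hA0 hA, ENNReal.rpow_one,
      div_eq_mul_inv, mul_assoc, mul_comm _ A, div_eq_mul_inv A]
  have hRN : (R⁻¹) ^ γ * N = P := by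
    rw [hR, hP, ← ENNReal.inv_rpow, ENNReal.inv_div (Or.inl hA) (Or.inl hA0), ← ENNReal.rpow_mul,
      ENNReal.div_rpow_of_nonneg _ _ (by positivity), div_eq_mul_inv, ← ENNReal.rpow_neg, mul_assoc]
    nth_rewrite 2 [← ENNReal.rpow_one N]
    rw [← ENNReal.rpow_add _ _ hN0 hN, mul_comm]
    congr 2 <;> (field_simp; try ring)
  -- Use the growing bound below `R` and the decaying one above. The factor 2 in `2 * R⁻¹` turns `2
  -- ^ (-k) ≤ R⁻¹` into the strict inequality that the level sums require.
  have key : ∀ k : ℤ, min ((2 : ℝ≥0∞) ^ k * A) (((2 : ℝ≥0∞) ^ k) ^ (-γ) * N) ≤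
      (if (2 : ℝ≥0∞) ^ k < R then ((2 : ℝ≥0∞) ^ k) ^ (1 : ℝ) else 0) * A +
      (if (2 : ℝ≥0∞) ^ (-k) < 2 * R⁻¹ then ((2 : ℝ≥0∞) ^ (-k)) ^ γ else 0) * N := by
    intro k
    by_cases hk : (2 : ℝ≥0∞) ^ k < R
    · rw [if_pos hk, ENNReal.rpow_one]
      exact (min_le_left _ _).trans (le_add_of_nonneg_right (zero_le))
    · have h3 : (2 : ℝ≥0∞) ^ (-k) < 2 * R⁻¹ := by
        rw [ENNReal.zpow_neg]
        calc ((2 : ℝ≥0∞) ^ k)⁻¹ ≤ R⁻¹ := ENNReal.inv_le_inv.2 (not_lt.1 hk)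
          _ < 2 * R⁻¹ := by
            rw [two_mul]
            exact ENNReal.lt_add_right (ENNReal.inv_ne_top.2 hR0) (ENNReal.inv_ne_zero.2 hRt)
      rw [if_pos h3, ENNReal.zpow_neg, ENNReal.inv_rpow, ← ENNReal.rpow_neg]
      exact (min_le_right _ _).trans (le_add_of_nonneg_left (zero_le))
  calc _ ≤ _ := ENNReal.tsum_le_tsum key
    _ = (∑' k : ℤ, (if (2 : ℝ≥0∞) ^ k < R then ((2 : ℝ≥0∞) ^ k) ^ (1 : ℝ) else 0)) * A +
      (∑' k : ℤ, (if (2 : ℝ≥0∞) ^ (-k) < 2 * R⁻¹ then ((2 : ℝ≥0∞) ^ (-k)) ^ γ else 0)) * N := by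
        rw [ENNReal.tsum_add, ENNReal.tsum_mul_right, ENNReal.tsum_mul_right]
    _ ≤ (C₁ * R ^ (1 : ℝ)) * A + (C₂ * (2 * R⁻¹) ^ γ) * N := by
        gcongr
        · exact h₁ R
        · exact ((Equiv.neg ℤ).tsum_eq
            (fun k : ℤ => if (2 : ℝ≥0∞) ^ k < 2 * R⁻¹ then ((2 : ℝ≥0∞) ^ k) ^ γ else 0)).le.trans
            (h₂ _)
    _ = (C₁ + C₂ * 2 ^ γ) * P := by
        rw [ENNReal.mul_rpow_of_nonneg _ _ hγ.le, ENNReal.rpow_one, mul_assoc, hRA,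
          ← mul_assoc (C₂ : ℝ≥0∞), mul_assoc _ _ N, hRN, add_mul]
    _ = _ := by
        rw [hP, mul_assoc]; congr 1
        push_cast [ENNReal.coe_rpow_of_nonneg _ hγ.le]; rfl

end DyadicSums

/-! ### The maximal function of a doubling measure: weak type (1,1) and `L^p` bounds. -/

section MaximalFunction

variable {X : Type*} [PseudoMetricSpace X] [MeasurableSpace X]

/-- The uncentred maximal function over open balls, with respect to `μ`. -/
noncomputable def maximalFunction (μ : Measure X) (g : X → ℝ≥0∞) (x : X) : ℝ≥0∞ :=
  ⨆ (c : X) (r : ℝ) (_ : x ∈ Metric.ball c r), ⨍⁻ y in Metric.ball c r, g y ∂μ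

theorem lt_maximalFunction_iff {μ : Measure X} {g : X → ℝ≥0∞} {x : X} {t : ℝ≥0∞} :
    t < maximalFunction μ g x ↔
      ∃ (c : X) (r : ℝ), x ∈ Metric.ball c r ∧ t < ⨍⁻ y in Metric.ball c r, g y ∂μ := by
  simp [maximalFunction, lt_iSup_iff]

theorem setLAverage_le_maximalFunction (μ : Measure X) (g : X → ℝ≥0∞) {x c : X} {r : ℝ}
    (h : x ∈ Metric.ball c r) :
    ⨍⁻ y in Metric.ball c r, g y ∂μ ≤ maximalFunction μ g x :=
  le_iSup_of_le c <| le_iSup_of_le r <| le_iSup_of_le h le_rfl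

theorem maximalFunction_congr_ae {μ : Measure X} {g g' : X → ℝ≥0∞} (h : g =ᵐ[μ] g') :
    maximalFunction μ g = maximalFunction μ g' := by
  ext x
  unfold maximalFunction
  refine iSup_congr fun c => iSup_congr fun r => iSup_congr fun _ => ?_
  exact laverage_congr (ae_restrict_of_ae h)

/-- Superlevel sets are open, because a ball witnessing the bound at one point witnesses it at all
its points; `g` itself may be arbitrary. -/
theorem measurable_maximalFunction [OpensMeasurableSpace X] (μ : Measure X) (g : X → ℝ≥0∞) :
    Measurable (maximalFunction μ g) := by
  refine measurable_of_Ioi fun t => ?_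
  refine IsOpen.measurableSet ?_
  rw [isOpen_iff_mem_nhds]
  intro x hx
  obtain ⟨c, r, hxc, ht⟩ := lt_maximalFunction_iff.1 hx
  filter_upwards [Metric.isOpen_ball.mem_nhds hxc] with y hy
  exact lt_maximalFunction_iff.2 ⟨c, r, hy, ht⟩

/-- The maximal function is controlled by its part coming from large values. -/
theorem maximalFunction_le_indicator_add (μ : Measure X) (g : X → ℝ≥0∞)
    (t : ℝ≥0∞) (x : X) :
    maximalFunction μ g x ≤ maximalFunction μ ({y | t < g y}.indicator g) x + t := by
  refine iSup_le fun c => iSup_le fun r => iSup_le fun hx => ?_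
  have hle : ∀ y, g y ≤ {y | t < g y}.indicator g y + t := by
    intro y
    by_cases h : t < g y
    · simp [indicator, h]
    · simp [indicator, h]; exact not_lt.1 h
  calc ⨍⁻ y in Metric.ball c r, g y ∂μ
      ≤ ⨍⁻ y in Metric.ball c r, ({y | t < g y}.indicator g y + t) ∂μ := by
        exact lintegral_mono hle
    _ = ⨍⁻ y in Metric.ball c r, {y | t < g y}.indicator g y ∂μ +
          ⨍⁻ _y in Metric.ball c r, t ∂μ := by
        exact lintegral_add_right _ measurable_const
    _ ≤ _ := by
        gcongr
        · exact setLAverage_le_maximalFunction _ _ hx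
        · rw [setLAverage_eq, setLIntegral_const]
          exact ENNReal.div_le_of_le_mul le_rfl

variable [OpensMeasurableSpace X] [SecondCountableTopology X]

/-- The weak type `(1,1)` inequality for the maximal function of a doubling measure. -/
theorem mul_measure_lt_maximalFunction_le {μ : Measure X} {D : ℝ≥0∞}
    (hD : ∀ x r, μ (Metric.ball x (4 * r)) ≤ D * μ (Metric.ball x r))
    (g : X → ℝ≥0∞) (t : ℝ≥0∞) :
    t * μ {x | t < maximalFunction μ g x} ≤ D * ∫⁻ x, g x ∂μ := by
  -- Vitali covering needs bounded radii, so the superlevel set is exhausted by the parts seen by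
  -- balls of radius at most `R`.
  set S : ℕ → Set X := fun R => {x | ∃ (c : X) (r : ℝ), r ≤ R ∧ x ∈ Metric.ball c r ∧
    t < ⨍⁻ y in Metric.ball c r, g y ∂μ} with hS
  have hmono : Monotone S := by
    rintro R R' hR x ⟨c, r, h1, h2⟩
    exact ⟨c, r, h1.trans (by exact_mod_cast hR), h2⟩
  have hU : {x | t < maximalFunction μ g x} = ⋃ R, S R := by
    ext x
    simp only [mem_ofPred_eq, lt_maximalFunction_iff, mem_iUnion, hS]
    constructor
    · rintro ⟨c, r, h⟩
      obtain ⟨R, hR⟩ := exists_nat_ge r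
      exact ⟨R, c, r, hR, h⟩
    · rintro ⟨R, c, r, -, h⟩
      exact ⟨c, r, h⟩
  rw [hU, hmono.measure_iUnion, ENNReal.mul_iSup]
  refine iSup_le fun R => ?_
  obtain ⟨u, hut, hdisj, hcov⟩ := Vitali.exists_disjoint_subfamily_covering_enlargement_ball
    {b : X × ℝ | b.2 ≤ R ∧ t < ⨍⁻ y in Metric.ball b.1 b.2, g y ∂μ} Prod.fst Prod.snd R
    (fun a ha => ha.1) 4 (by norm_num)
  have hcount : u.Countable := by
    -- Disjoint nonempty open sets are countable; an empty ball has average 0, hence is never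
    -- selected.
    refine hdisj.countable_of_isOpen (fun _ _ => Metric.isOpen_ball) fun b hb => ?_
    by_contra hne
    have := (hut hb).2
    rw [not_nonempty_iff_eq_empty.1 hne] at this
    simp at this
  have := hcount.to_subtype
  have hsub : S R ⊆ ⋃ b : u, Metric.ball b.1.1 (4 * b.1.2) := by
    rintro x ⟨c, r, hr, hx, ht⟩
    obtain ⟨b, hb, hsub⟩ := hcov (c, r) ⟨hr, ht⟩
    exact mem_iUnion.2 ⟨⟨b, hb⟩, hsub hx⟩
  calc t * μ (S R) ≤ t * ∑' b : u, μ (Metric.ball b.1.1 (4 * b.1.2)) := by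
        gcongr
        exact (measure_mono hsub).trans (measure_iUnion_le _)
    _ ≤ t * ∑' b : u, D * μ (Metric.ball b.1.1 b.1.2) := by
        gcongr
        exact hD _ _
    _ = D * ∑' b : u, t * μ (Metric.ball b.1.1 b.1.2) := by
        rw [ENNReal.tsum_mul_left, ENNReal.tsum_mul_left, mul_left_comm]
    _ ≤ D * ∑' b : u, ∫⁻ y in Metric.ball b.1.1 b.1.2, g y ∂μ := by
        gcongr with b
        refine ENNReal.mul_le_of_le_div ?_
        rw [← setLAverage_eq]
        exact (hut b.2).2.le
    _ = D * ∫⁻ y in ⋃ b : u, Metric.ball b.1.1 b.1.2, g y ∂μ := by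
        rw [lintegral_iUnion (fun _ => Metric.isOpen_ball.measurableSet)]
        intro b b' hbb
        exact hdisj b.2 b'.2 (fun h => hbb (Subtype.ext h))
    _ ≤ D * ∫⁻ x, g x ∂μ := mul_le_mul_right (setLIntegral_le_lintegral _ _) _

/-- The maximal function of a doubling measure is bounded on `L^p`, `p > 1`. -/
theorem lintegral_maximalFunction_rpow_le {D : ℝ≥0} {p : ℝ} (hp : 1 < p) :
    ∃ C : ℝ≥0, ∀ μ : Measure X,
      (∀ x r, μ (Metric.ball x (4 * r)) ≤ D * μ (Metric.ball x r)) →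
      ∀ g : X → ℝ≥0∞, AEMeasurable g μ →
        ∫⁻ x, maximalFunction μ g x ^ p ∂μ ≤ C * ∫⁻ x, g x ^ p ∂μ := by
  -- This is where `p > 1` enters: the level sum of `2^(k(p-1))` over `2^k < g` must be of size
  -- `g^(p-1)`.
  obtain ⟨C₀, hC₀⟩ := tsum_zpow_lt_rpow_le (ε := p - 1) (by linarith)
  refine ⟨2 ^ p * (2 ^ p * D * C₀), fun μ hD g₀ hg₀ => ?_⟩
  obtain ⟨g, hg, hgg⟩ := hg₀
  have hgp : ∫⁻ x, g₀ x ^ p ∂μ = ∫⁻ x, g x ^ p ∂μ := lintegral_congr_ae (hgg.fun_comp (· ^ p))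
  rw [maximalFunction_congr_ae hgg, hgp]
  clear hgg hgp
  have hp0 : 0 < p := by linarith
  -- Values of `g` below `2^k` add at most `2^k` to the maximal function, so above level `2^(k+1)`
  -- the large values alone reach `2^k`, and the weak type bound applies to them.
  have hlevel : ∀ k : ℤ, μ {x | (2 : ℝ≥0∞) ^ (k + 1) < maximalFunction μ g x} ≤
      ((2 : ℝ≥0∞) ^ k)⁻¹ * (D * ∫⁻ x, {y | (2 : ℝ≥0∞) ^ k < g y}.indicator g x ∂μ) := by
    intro k
    have h0 : (2 : ℝ≥0∞) ^ k ≠ 0 := (ENNReal.zpow_pos (by norm_num) (by norm_num) k).ne'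
    have ht : (2 : ℝ≥0∞) ^ k ≠ ⊤ := (ENNReal.zpow_lt_top (by norm_num) (by norm_num) k).ne
    rw [mul_comm, ← div_eq_mul_inv, ENNReal.le_div_iff_mul_le (Or.inl h0) (Or.inl ht), mul_comm]
    refine le_trans ?_ (mul_measure_lt_maximalFunction_le hD _ ((2 : ℝ≥0∞) ^ k))
    refine mul_le_mul_right (measure_mono fun x hx => ?_) _
    have h1 := (mem_ofPred_eq ▸ hx).trans_le (maximalFunction_le_indicator_add μ g ((2 : ℝ≥0∞) ^ k) x)
    rw [ENNReal.zpow_add (by norm_num) (by norm_num), zpow_one, mul_two] at h1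
    exact (ENNReal.add_lt_add_iff_right ht).1 h1
  have hmeas : ∀ t : ℝ≥0∞, MeasurableSet {y | t < g y} := fun t => hg measurableSet_Ioi
  calc ∫⁻ x, maximalFunction μ g x ^ p ∂μ
      ≤ ∫⁻ x, 2 ^ p * ∑' k : ℤ, (if (2 : ℝ≥0∞) ^ k < maximalFunction μ g x
          then ((2 : ℝ≥0∞) ^ k) ^ p else 0) ∂μ :=
        lintegral_mono fun x => rpow_le_tsum_zpow hp0 _
    _ = 2 ^ p * ∑' k : ℤ, ((2 : ℝ≥0∞) ^ k) ^ p *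
          μ {x | (2 : ℝ≥0∞) ^ k < maximalFunction μ g x} := by
        have hm : ∀ k : ℤ, MeasurableSet {x | (2 : ℝ≥0∞) ^ k < maximalFunction μ g x} :=
          fun k => measurable_maximalFunction μ g measurableSet_Ioi
        have hi : ∀ (k : ℤ) (x : X), (if (2 : ℝ≥0∞) ^ k < maximalFunction μ g x
            then ((2 : ℝ≥0∞) ^ k) ^ p else 0) =
            {x | (2 : ℝ≥0∞) ^ k < maximalFunction μ g x}.indicator
              (fun _ => ((2 : ℝ≥0∞) ^ k) ^ p) x := fun k x => by simp [indicator]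
        rw [lintegral_const_mul', lintegral_tsum]
        · simp_rw [hi]
          congr 2 with k
          rw [lintegral_indicator_const (hm k)]
        · intro k
          simp_rw [hi]
          exact (measurable_const.indicator (hm k)).aemeasurable
        · exact ENNReal.rpow_ne_top_of_nonneg hp0.le (by norm_num)
    _ = 2 ^ p * ∑' k : ℤ, ((2 : ℝ≥0∞) ^ (k + 1)) ^ p *
          μ {x | (2 : ℝ≥0∞) ^ (k + 1) < maximalFunction μ g x} := by
        congr 1
        exact ((Equiv.addRight (1 : ℤ)).tsum_eq (fun k : ℤ => ((2 : ℝ≥0∞) ^ k) ^ p *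
          μ {x | (2 : ℝ≥0∞) ^ k < maximalFunction μ g x})).symm
    _ ≤ 2 ^ p * ∑' k : ℤ, ((2 : ℝ≥0∞) ^ (k + 1)) ^ p * (((2 : ℝ≥0∞) ^ k)⁻¹ *
          (D * ∫⁻ x, {y | (2 : ℝ≥0∞) ^ k < g y}.indicator g x ∂μ)) := by
        gcongr with k
        exact hlevel k
    _ = 2 ^ p * ∑' k : ℤ, 2 ^ p * D * ∫⁻ x, (if (2 : ℝ≥0∞) ^ k < g x
          then ((2 : ℝ≥0∞) ^ k) ^ (p - 1) else 0) * g x ∂μ := by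
        congr 2 with k
        have h0 : (2 : ℝ≥0∞) ^ k ≠ 0 := (ENNReal.zpow_pos (by norm_num) (by norm_num) k).ne'
        have ht : (2 : ℝ≥0∞) ^ k ≠ ⊤ := (ENNReal.zpow_lt_top (by norm_num) (by norm_num) k).ne
        have h3 : ∀ x, (if (2 : ℝ≥0∞) ^ k < g x
          then ((2 : ℝ≥0∞) ^ k) ^ (p - 1) else 0) * g x =
          ((2 : ℝ≥0∞) ^ k) ^ (p - 1) * {y | (2 : ℝ≥0∞) ^ k < g y}.indicator g x := by
          intro x; by_cases h : (2 : ℝ≥0∞) ^ k < g x <;> simp [indicator, h]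
        simp_rw [h3]
        rw [lintegral_const_mul' _ _ (ENNReal.rpow_ne_top_of_nonneg (by linarith) ht),
          ENNReal.zpow_add (by norm_num) (by norm_num), zpow_one,
          ENNReal.mul_rpow_of_nonneg _ _ hp0.le, ENNReal.rpow_sub _ _ h0 ht, ENNReal.rpow_one,
          div_eq_mul_inv]
        ring
    _ = 2 ^ p * (2 ^ p * D * ∫⁻ x, (∑' k : ℤ, (if (2 : ℝ≥0∞) ^ k < g x
          then ((2 : ℝ≥0∞) ^ k) ^ (p - 1) else 0)) * g x ∂μ) := by
        rw [ENNReal.tsum_mul_left]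
        simp_rw [← ENNReal.tsum_mul_right]
        rw [lintegral_tsum]
        intro k
        refine (Measurable.mul ?_ hg).aemeasurable
        exact Measurable.ite (hmeas _) measurable_const measurable_const
    _ ≤ 2 ^ p * (2 ^ p * D * ∫⁻ x, C₀ * g x ^ p ∂μ) := by
        refine mul_le_mul_right (mul_le_mul_right (lintegral_mono fun x => ?_) _) _
        calc _ ≤ C₀ * g x ^ (p - 1) * g x := mul_le_mul_left (hC₀ _) _
          _ = C₀ * g x ^ p := by
              rw [mul_assoc]
              congr 1
              nth_rewrite 2 [← ENNReal.rpow_one (g x)]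
              rw [← ENNReal.rpow_add_of_nonneg _ _ (by linarith) (by norm_num)]
              congr 1; ring
    _ = _ := by
        rw [lintegral_const_mul' _ _ ENNReal.coe_ne_top]
        push_cast [ENNReal.coe_rpow_of_nonneg _ hp0.le]
        ring

end MaximalFunction

/-! ### Muckenhoupt weights and the weighted maximal theorem. -/

section Muckenhoupt

variable {n : ℕ}

theorem volume_ball_four_mul (x : Rn n) (r : ℝ) :
    volume (Metric.ball x (4 * r)) = 4 ^ n * volume (Metric.ball x r) := by
  have := Measure.addHaar_ball_mul_of_pos (volume : Measure (Rn n)) x (r := 4) (by norm_num) r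
  rw [this, finrank_euclideanSpace_fin, ENNReal.ofReal_pow (by norm_num),
    Measure.addHaar_ball_center _ x]
  norm_num

variable {s : ℝ} {W : Rn n → ℝ≥0∞}

/-- Hölder applied to `1 = W^(1/s) · W^(-1/s)`. It is the reverse of the `A_s` inequality; the two
together give doubling and the nondegeneracy of the masses of balls. -/
theorem measure_rpow_le_lintegral_mul_lintegral_rpow (hs : 1 < s) (hW : AEMeasurable W)
    (h0 : ∀ᵐ x, W x ≠ 0) (ht : ∀ᵐ x, W x ≠ ⊤) (B : Set (Rn n)) :
    volume B ^ s ≤ (∫⁻ y in B, W y) * (∫⁻ y in B, W y ^ (-(1 / (s - 1)))) ^ (s - 1) := by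
  have hs0 : 0 < s := by linarith
  have hs1 : s - 1 ≠ 0 := by linarith
  have hconj : s.HolderConjugate (s / (s - 1)) := Real.HolderConjugate.conjExponent hs
  have key := ENNReal.lintegral_mul_le_Lp_mul_Lq (volume.restrict B) hconj
    (f := fun y => W y ^ (1 / s)) (g := fun y => W y ^ (-(1 / s)))
    (hW.restrict.pow_const _) (hW.restrict.pow_const _)
  have h1 : ∫⁻ y in B, ((fun y => W y ^ (1 / s)) * (fun y => W y ^ (-(1 / s)))) y = volume B := by
    rw [← setLIntegral_one]
    refine lintegral_congr_ae ?_
    filter_upwards [ae_restrict_of_ae h0, ae_restrict_of_ae ht] with y hy0 hyt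
    simp only [Pi.mul_apply]
    rw [← ENNReal.rpow_add _ _ hy0 hyt]; simp
  have h2 : ∀ y, (W y ^ (1 / s)) ^ s = W y := fun y => by
    rw [← ENNReal.rpow_mul, one_div_mul_cancel hs0.ne', ENNReal.rpow_one]
  have h3 : ∀ y, (W y ^ (-(1 / s))) ^ (s / (s - 1)) = W y ^ (-(1 / (s - 1))) := fun y => by
    rw [← ENNReal.rpow_mul]; congr 1; field_simp
  rw [h1] at key
  simp_rw [h2, h3] at key
  calc volume B ^ s ≤ _ := ENNReal.rpow_le_rpow key hs0.le
    _ = _ := by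
      rw [ENNReal.mul_rpow_of_nonneg _ _ hs0.le, ← ENNReal.rpow_mul, ← ENNReal.rpow_mul,
        one_div_mul_cancel hs0.ne', ENNReal.rpow_one]
      congr 2; field_simp

variable {A : ℝ≥0}

/-- With `σ = W^(-1/(s-1))`: `W(4B) |B|^s ≤ W(4B) W(B) σ(4B)^(s-1) ≤ A W(B) |4B|^s`, by Hölder on
`B` and then `A_s` on `4B`. Only the volume is cancelled. -/
theorem withDensity_ball_four_mul_le (hs : 1 < s) (hW : AEMeasurable W)
    (h0 : ∀ᵐ x, W x ≠ 0) (ht : ∀ᵐ x, W x ≠ ⊤)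
    (hA : ∀ c r, 0 < r → (∫⁻ y in Metric.ball c r, W y) *
      (∫⁻ y in Metric.ball c r, W y ^ (-(1 / (s - 1)))) ^ (s - 1) ≤
        A * volume (Metric.ball c r) ^ s) (x : Rn n) (r : ℝ) :
    ∫⁻ y in Metric.ball x (4 * r), W y ≤
      ((A * (4 ^ n) ^ s : ℝ≥0) : ℝ≥0∞) * ∫⁻ y in Metric.ball x r, W y := by
  rcases le_or_gt r 0 with hr | hr
  · rw [Metric.ball_eq_empty.2 (by linarith : 4 * r ≤ 0)]; simp
  have hv0 : volume (Metric.ball x r) ^ s ≠ 0 :=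
    (ENNReal.rpow_pos (Metric.measure_ball_pos _ _ hr) measure_ball_lt_top.ne).ne'
  have hvt : volume (Metric.ball x r) ^ s ≠ ⊤ :=
    ENNReal.rpow_ne_top_of_nonneg (by linarith) measure_ball_lt_top.ne
  rw [← ENNReal.mul_le_mul_iff_left hv0 hvt]
  calc _ ≤ (∫⁻ y in Metric.ball x (4 * r), W y) * ((∫⁻ y in Metric.ball x r, W y) *
        (∫⁻ y in Metric.ball x (4 * r), W y ^ (-(1 / (s - 1)))) ^ (s - 1)) := by
        refine mul_le_mul_right ((measure_rpow_le_lintegral_mul_lintegral_rpow hs hW h0 ht _).trans ?_) _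
        refine mul_le_mul_right (ENNReal.rpow_le_rpow (lintegral_mono_set ?_) (by linarith)) _
        exact Metric.ball_subset_ball (by linarith)
    _ = (∫⁻ y in Metric.ball x r, W y) * ((∫⁻ y in Metric.ball x (4 * r), W y) *
        (∫⁻ y in Metric.ball x (4 * r), W y ^ (-(1 / (s - 1)))) ^ (s - 1)) := by ring
    _ ≤ (∫⁻ y in Metric.ball x r, W y) * (A * volume (Metric.ball x (4 * r)) ^ s) :=
        mul_le_mul_right (hA _ _ (by linarith)) _
    _ = _ := by
        rw [volume_ball_four_mul, ENNReal.mul_rpow_of_nonneg _ _ (by linarith)]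
        push_cast [ENNReal.coe_rpow_of_nonneg _ (by linarith : 0 ≤ s)]
        ring

/-- The same argument with the roles of `W` and its dual weight exchanged, after raising to the
power `s - 1`. -/
theorem withDensity_dual_ball_four_mul_le (hs : 1 < s) (hW : AEMeasurable W)
    (h0 : ∀ᵐ x, W x ≠ 0) (ht : ∀ᵐ x, W x ≠ ⊤)
    (hA : ∀ c r, 0 < r → (∫⁻ y in Metric.ball c r, W y) *
      (∫⁻ y in Metric.ball c r, W y ^ (-(1 / (s - 1)))) ^ (s - 1) ≤
        A * volume (Metric.ball c r) ^ s) (x : Rn n) (r : ℝ) :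
    ∫⁻ y in Metric.ball x (4 * r), W y ^ (-(1 / (s - 1))) ≤
      (((A * (4 ^ n) ^ s) ^ (1 / (s - 1)) : ℝ≥0) : ℝ≥0∞) *
        ∫⁻ y in Metric.ball x r, W y ^ (-(1 / (s - 1))) := by
  rcases le_or_gt r 0 with hr | hr
  · rw [Metric.ball_eq_empty.2 (by linarith : 4 * r ≤ 0)]; simp
  have hs' : 0 < s - 1 := by linarith
  have hv0 : volume (Metric.ball x r) ^ s ≠ 0 :=
    (ENNReal.rpow_pos (Metric.measure_ball_pos _ _ hr) measure_ball_lt_top.ne).ne'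
  have hvt : volume (Metric.ball x r) ^ s ≠ ⊤ :=
    ENNReal.rpow_ne_top_of_nonneg (by linarith) measure_ball_lt_top.ne
  rw [← ENNReal.rpow_le_rpow_iff hs', ENNReal.mul_rpow_of_nonneg _ _ hs'.le,
    ← ENNReal.coe_rpow_of_nonneg _ hs'.le, ← NNReal.rpow_mul, one_div_mul_cancel hs'.ne',
    NNReal.rpow_one, ← ENNReal.mul_le_mul_iff_left hv0 hvt]
  set S := fun y => W y ^ (-(1 / (s - 1)))
  calc (∫⁻ y in Metric.ball x (4 * r), S y) ^ (s - 1) * volume (Metric.ball x r) ^ s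
      ≤ (∫⁻ y in Metric.ball x (4 * r), S y) ^ (s - 1) * ((∫⁻ y in Metric.ball x (4 * r), W y) *
        (∫⁻ y in Metric.ball x r, S y) ^ (s - 1)) := by
        refine mul_le_mul_right ((measure_rpow_le_lintegral_mul_lintegral_rpow hs hW h0 ht _).trans ?_) _
        refine mul_le_mul_left (lintegral_mono_set ?_) _
        exact Metric.ball_subset_ball (by linarith)
    _ = (∫⁻ y in Metric.ball x r, S y) ^ (s - 1) * ((∫⁻ y in Metric.ball x (4 * r), W y) *
        (∫⁻ y in Metric.ball x (4 * r), S y) ^ (s - 1)) := by ring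
    _ ≤ (∫⁻ y in Metric.ball x r, S y) ^ (s - 1) * (A * volume (Metric.ball x (4 * r)) ^ s) :=
        mul_le_mul_right (hA _ _ (by linarith)) _
    _ = _ := by
        rw [volume_ball_four_mul, ENNReal.mul_rpow_of_nonneg _ _ (by linarith)]
        push_cast [ENNReal.coe_rpow_of_nonneg _ (by linarith : 0 ≤ s)]
        ring

/-- Lerner's pointwise bound of the maximal function by weighted maximal functions. -/
theorem maximalFunction_rpow_le (hs : 1 < s) (hW : AEMeasurable W)
    (h0 : ∀ᵐ x, W x ≠ 0) (ht : ∀ᵐ x, W x ≠ ⊤)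
    (hA : ∀ c r, 0 < r → (∫⁻ y in Metric.ball c r, W y) *
      (∫⁻ y in Metric.ball c r, W y ^ (-(1 / (s - 1)))) ^ (s - 1) ≤
        A * volume (Metric.ball c r) ^ s) {f : Rn n → ℝ≥0∞} (hf : AEMeasurable f) (x : Rn n) :
    maximalFunction volume f x ^ (s - 1) ≤ A * maximalFunction (volume.withDensity W)
      (fun y => maximalFunction (volume.withDensity fun y => W y ^ (-(1 / (s - 1))))
        (fun z => f z * (W z ^ (-(1 / (s - 1))))⁻¹) y ^ (s - 1) * (W y)⁻¹) x := by
  have hs' : 0 < s - 1 := by linarith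
  set S := fun y => W y ^ (-(1 / (s - 1))) with hS
  have hSm : AEMeasurable S := hW.pow_const _
  set H := maximalFunction (volume.withDensity S) (fun z => f z * (S z)⁻¹) with hH
  rw [← ENNReal.le_rpow_inv_iff hs']
  refine iSup_le fun c => iSup_le fun r => iSup_le fun hx => ?_
  rw [ENNReal.le_rpow_inv_iff hs']
  have hr : 0 < r := Metric.pos_of_mem_ball hx
  set B := Metric.ball c r with hB
  have hBm : MeasurableSet B := Metric.isOpen_ball.measurableSet
  have hv0 : volume B ≠ 0 := (Metric.measure_ball_pos _ _ hr).ne'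
  have hvt : volume B ≠ ⊤ := measure_ball_lt_top.ne
  have hle := measure_rpow_le_lintegral_mul_lintegral_rpow hs hW h0 ht B
  have hAB := hA c r hr
  rw [← hB] at hAB
  change volume B ^ s ≤ (∫⁻ y in B, W y) * (∫⁻ y in B, S y) ^ (s - 1) at hle
  change (∫⁻ y in B, W y) * (∫⁻ y in B, S y) ^ (s - 1) ≤ A * volume B ^ s at hAB
  have hvs0 : 0 < volume B ^ s := ENNReal.rpow_pos (pos_iff_ne_zero.2 hv0) hvt
  have hvst : volume B ^ s ≠ ⊤ := ENNReal.rpow_ne_top_of_nonneg (by linarith) hvt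
  -- The product of the two masses lies between positive finite quantities, so each factor is itself
  -- nonzero and finite and can be cancelled below.
  have hprod0 := (hvs0.trans_le hle).ne'
  have hprodt := (hAB.trans_lt (ENNReal.mul_lt_top ENNReal.coe_lt_top hvst.lt_top)).ne
  set wB := ∫⁻ y in B, W y with hwB
  set sB := ∫⁻ y in B, S y with hsB
  have hw0 : wB ≠ 0 := left_ne_zero_of_mul hprod0
  have hs0' : sB ^ (s - 1) ≠ 0 := right_ne_zero_of_mul hprod0
  have hwt : wB ≠ ⊤ := fun h => hprodt (by rw [h, ENNReal.top_mul hs0'])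
  have hst' : sB ^ (s - 1) ≠ ⊤ := fun h => hprodt (by rw [h, ENNReal.mul_top hw0])
  have hS0 : ∀ᵐ y, S y ≠ 0 ∧ S y ≠ ⊤ := by
    filter_upwards [h0, ht] with y hy0 hyt
    simp only [hS]
    exact ⟨by simp [ENNReal.rpow_eq_zero_iff, hy0, hyt], by simp [ENNReal.rpow_eq_top_iff, hy0, hyt]⟩
  have hfS : AEMeasurable (fun z => f z * (S z)⁻¹) := hf.mul hSm.inv
  have hHm : Measurable H := measurable_maximalFunction _ _
  have hHW : AEMeasurable (fun y => H y ^ (s - 1) * (W y)⁻¹) :=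
    (hHm.pow_const _).aemeasurable.mul hW.inv
  have hint : ∫⁻ y in B, f y = ∫⁻ y in B, f y * (S y)⁻¹ ∂(volume.withDensity S) := by
    rw [restrict_withDensity hBm, lintegral_withDensity_eq_lintegral_mul₀ hSm.restrict
      hfS.restrict]
    refine lintegral_congr_ae ?_
    filter_upwards [ae_restrict_of_ae hS0] with y hy
    simp only [Pi.mul_apply]
    rw [mul_left_comm, ENNReal.mul_inv_cancel hy.1 hy.2, mul_one]
  have havg : ∀ y ∈ B, (∫⁻ y in B, f y) / sB ≤ H y := by
    intro y hy
    have := setLAverage_le_maximalFunction (volume.withDensity S) (fun z => f z * (S z)⁻¹) hy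
    rwa [setLAverage_eq, ← hB, ← hint, withDensity_apply _ hBm] at this
  -- By `havg` the constant `(∫_B f / σ(B))^(s-1)` is below `H^(s-1)` on `B`. Averaging `H^(s-1)
  -- W⁻¹` against `W dx` cancels the weight and leaves `|B| / W(B)`.
  have hK : ((∫⁻ y in B, f y) / sB) ^ (s - 1) * volume B / wB ≤
      maximalFunction (volume.withDensity W) (fun y => H y ^ (s - 1) * (W y)⁻¹) x := by
    refine le_trans ?_ (setLAverage_le_maximalFunction _ _ hx)
    rw [setLAverage_eq, withDensity_apply _ hBm]
    refine ENNReal.div_le_div_right ?_ _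
    rw [← hB, restrict_withDensity hBm, lintegral_withDensity_eq_lintegral_mul₀ hW.restrict
      hHW.restrict, ← setLIntegral_const]
    refine lintegral_mono_ae ?_
    filter_upwards [ae_restrict_of_ae h0, ae_restrict_of_ae ht, ae_restrict_mem hBm] with y hy0 hyt hy
    simp only [Pi.mul_apply]
    rw [mul_left_comm, ENNReal.mul_inv_cancel hy0 hyt, mul_one]
    exact ENNReal.rpow_le_rpow (havg y hy) hs'.le
  refine le_trans ?_ (mul_le_mul_right hK _)
  rw [setLAverage_eq, ENNReal.div_rpow_of_nonneg _ _ hs'.le, ENNReal.div_rpow_of_nonneg _ _ hs'.le]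
  have hvs : volume B ^ s = volume B ^ (s - 1) * volume B := by
    nth_rewrite 3 [← ENNReal.rpow_one (volume B)]
    rw [← ENNReal.rpow_add _ _ hv0 hvt]; congr 1; ring
  rw [hvs] at hAB
  set F := (∫⁻ y in B, f y) ^ (s - 1)
  have hu0 : volume B ^ (s - 1) ≠ 0 := (ENNReal.rpow_pos (pos_iff_ne_zero.2 hv0) hvt).ne'
  have hut : volume B ^ (s - 1) ≠ ⊤ := ENNReal.rpow_ne_top_of_nonneg hs'.le hvt
  refine ENNReal.div_le_of_le_mul ?_
  set u := volume B ^ (s - 1)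
  set σ' := sB ^ (s - 1)
  calc F = F * (wB⁻¹ * wB) * (σ'⁻¹ * σ') := by
        rw [ENNReal.inv_mul_cancel hw0 hwt, ENNReal.inv_mul_cancel hs0' hst', mul_one, mul_one]
    _ = F * wB⁻¹ * σ'⁻¹ * (wB * σ') := by ring
    _ ≤ F * wB⁻¹ * σ'⁻¹ * (A * (u * volume B)) := mul_le_mul_right hAB _
    _ = _ := by simp only [div_eq_mul_inv]; ring

/-- Muckenhoupt's theorem: the maximal function is bounded on `L^s(w)` for `w ∈ A_s`. -/
theorem IsMuckenhouptWeight.lintegral_maximalFunction_rpow_le (hs : 1 < s) {w : Rn n → ℝ}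
    (hw : IsMuckenhouptWeight s w) :
    ∃ C : ℝ≥0, ∀ f : Rn n → ℝ≥0∞, AEMeasurable f →
      ∫⁻ x, maximalFunction volume f x ^ s ∂(weightedMeasure w) ≤
        C * ∫⁻ x, f x ^ s ∂(weightedMeasure w) := by
  have hs' : 0 < s - 1 := by linarith
  set W : Rn n → ℝ≥0∞ := fun x => ENNReal.ofReal (w x) with hWdef
  have hW : AEMeasurable W := hw.locallyIntegrable.aestronglyMeasurable.aemeasurable.ennreal_ofReal
  have h0 : ∀ᵐ x, W x ≠ 0 := by
    filter_upwards [hw.pos] with x hx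
    simpa [hWdef] using hx
  have ht : ∀ᵐ x, W x ≠ ⊤ := Eventually.of_forall fun x => ENNReal.ofReal_ne_top
  set A : ℝ≥0 := (muckenhouptCharacteristic s w).toNNReal with hAdef
  have hA : ∀ c r, 0 < r → (∫⁻ y in Metric.ball c r, W y) *
      (∫⁻ y in Metric.ball c r, W y ^ (-(1 / (s - 1)))) ^ (s - 1) ≤
        A * volume (Metric.ball c r) ^ s := by
    intro c r hr
    have h1 : (⨍⁻ y in Metric.ball c r, W y ∂volume) *
      (⨍⁻ y in Metric.ball c r, W y ^ (-(1 / (s - 1))) ∂volume) ^ (s - 1) ≤ A := by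
      rw [hAdef, ENNReal.coe_toNNReal hw.characteristic_lt_top.ne]
      exact le_iSup_of_le c (le_iSup_of_le r (le_iSup_of_le hr le_rfl))
    have hv0 : volume (Metric.ball c r) ≠ 0 := (Metric.measure_ball_pos _ _ hr).ne'
    have hvt : volume (Metric.ball c r) ≠ ⊤ := measure_ball_lt_top.ne
    rw [← measure_mul_setLAverage W hvt, ← measure_mul_setLAverage (fun y => W y ^ (-(1 / (s - 1)))) hvt,
      ENNReal.mul_rpow_of_nonneg _ _ hs'.le]
    have hvs : volume (Metric.ball c r) ^ s =
        volume (Metric.ball c r) * volume (Metric.ball c r) ^ (s - 1) := by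
      nth_rewrite 2 [← ENNReal.rpow_one (volume (Metric.ball c r))]
      rw [← ENNReal.rpow_add _ _ hv0 hvt]; congr 1; ring
    rw [hvs, mul_mul_mul_comm, mul_comm (A : ℝ≥0∞)]
    exact mul_le_mul_right h1 _
  set S : Rn n → ℝ≥0∞ := fun y => W y ^ (-(1 / (s - 1))) with hS
  have hSm : AEMeasurable S := hW.pow_const _
  -- The exponent conjugate to `s`, for which `(s - 1) t = s`: the outer maximal function is used on
  -- `L^t(W)`, the inner one on `L^s` of the dual weight.
  set t := s / (s - 1) with htdef
  have ht1 : 1 < t := by rw [htdef, one_lt_div hs']; linarith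
  obtain ⟨C₁, hC₁⟩ := RoughSingular.lintegral_maximalFunction_rpow_le (X := Rn n)
    (D := A * (4 ^ n) ^ s) ht1
  obtain ⟨C₂, hC₂⟩ := RoughSingular.lintegral_maximalFunction_rpow_le (X := Rn n)
    (D := (A * (4 ^ n) ^ s) ^ (1 / (s - 1))) hs
  have hbm : ∀ x r, MeasurableSet (Metric.ball (x : Rn n) r) :=
    fun x r => Metric.isOpen_ball.measurableSet
  replace hC₁ := hC₁ (volume.withDensity W) (fun x r => by
    rw [withDensity_apply _ (hbm _ _), withDensity_apply _ (hbm _ _)]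
    exact withDensity_ball_four_mul_le hs hW h0 ht hA x r)
  replace hC₂ := hC₂ (volume.withDensity S) (fun x r => by
    rw [withDensity_apply _ (hbm _ _), withDensity_apply _ (hbm _ _)]
    exact withDensity_dual_ball_four_mul_le hs hW h0 ht hA x r)
  refine ⟨A ^ t * (C₁ * C₂), fun f hf => ?_⟩
  change ∫⁻ x, maximalFunction volume f x ^ s ∂(volume.withDensity W) ≤
        _ * ∫⁻ x, f x ^ s ∂(volume.withDensity W)
  set H := maximalFunction (volume.withDensity S) (fun z => f z * (S z)⁻¹) with hH
  have hHm : Measurable H := measurable_maximalFunction _ _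
  have hfS : AEMeasurable (fun z => f z * (S z)⁻¹) := hf.mul hSm.inv
  have hHW : AEMeasurable (fun y => H y ^ (s - 1) * (W y)⁻¹) :=
    (hHm.pow_const _).aemeasurable.mul hW.inv
  have hpt : ∀ x, maximalFunction volume f x ^ s ≤ (A : ℝ≥0∞) ^ t *
      maximalFunction (volume.withDensity W) (fun y => H y ^ (s - 1) * (W y)⁻¹) x ^ t := by
    intro x
    have h1 := ENNReal.rpow_le_rpow (maximalFunction_rpow_le hs hW h0 ht hA hf x)
      (by positivity : 0 ≤ t)
    rw [← ENNReal.rpow_mul, ENNReal.mul_rpow_of_nonneg _ _ (by positivity)] at h1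
    have h2 : (s - 1) * t = s := by rw [htdef]; field_simp
    rwa [h2] at h1
  calc ∫⁻ x, maximalFunction volume f x ^ s ∂(volume.withDensity W)
      ≤ ∫⁻ x, (A : ℝ≥0∞) ^ t * maximalFunction (volume.withDensity W)
          (fun y => H y ^ (s - 1) * (W y)⁻¹) x ^ t ∂(volume.withDensity W) := lintegral_mono hpt
    _ = (A : ℝ≥0∞) ^ t * ∫⁻ x, maximalFunction (volume.withDensity W)
          (fun y => H y ^ (s - 1) * (W y)⁻¹) x ^ t ∂(volume.withDensity W) :=
        lintegral_const_mul' _ _ (ENNReal.rpow_ne_top_of_nonneg (by positivity) ENNReal.coe_ne_top)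
    _ ≤ (A : ℝ≥0∞) ^ t * (C₁ * ∫⁻ x, (H x ^ (s - 1) * (W x)⁻¹) ^ t ∂(volume.withDensity W)) := by
        refine mul_le_mul_right (hC₁ _ ?_) _
        exact hHW.mono_ac (withDensity_absolutelyContinuous _ _)
    -- The weights match because `W^(1-t) = W^(-1/(s-1)) = S`.
    _ = (A : ℝ≥0∞) ^ t * (C₁ * ∫⁻ x, H x ^ s ∂(volume.withDensity S)) := by
        congr 2
        rw [lintegral_withDensity_eq_lintegral_mul₀ hW
            (hHW.pow_const _),
          lintegral_withDensity_eq_lintegral_mul₀ hSm (hHm.pow_const _).aemeasurable]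
        refine lintegral_congr_ae ?_
        filter_upwards [h0, ht] with y hy0 hyt
        simp only [Pi.mul_apply, hS]
        have h2 : (s - 1) * t = s := by rw [htdef]; field_simp
        have h3 : -(1 / (s - 1)) = 1 - t := by rw [htdef]; field_simp; ring
        rw [ENNReal.mul_rpow_of_nonneg _ _ (by positivity), ← ENNReal.rpow_mul, h2, h3,
          ENNReal.rpow_sub _ _ hy0 hyt, ENNReal.rpow_one, ENNReal.inv_rpow, div_eq_mul_inv]
        ring
    _ ≤ (A : ℝ≥0∞) ^ t * (C₁ * (C₂ * ∫⁻ x, (f x * (S x)⁻¹) ^ s ∂(volume.withDensity S))) := by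
        refine mul_le_mul_right (mul_le_mul_right (hC₂ _ ?_) _) _
        exact hfS.mono_ac (withDensity_absolutelyContinuous _ _)
    -- Here `S^(1-s) = W` returns the original weight.
    _ = (A : ℝ≥0∞) ^ t * (C₁ * (C₂ * ∫⁻ x, f x ^ s ∂(volume.withDensity W))) := by
        congr 3
        rw [lintegral_withDensity_eq_lintegral_mul₀ hW (hf.pow_const _),
          lintegral_withDensity_eq_lintegral_mul₀ hSm (hfS.pow_const _)]
        refine lintegral_congr_ae ?_
        filter_upwards [h0, ht] with y hy0 hyt
        simp only [Pi.mul_apply, hS]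
        rw [ENNReal.mul_rpow_of_nonneg _ _ (by positivity), mul_left_comm, mul_comm (W y)]
        congr 1
        rw [← ENNReal.rpow_neg, ← ENNReal.rpow_mul, ← ENNReal.rpow_add _ _ hy0 hyt]
        nth_rewrite 2 [← ENNReal.rpow_one (W y)]
        congr 1
        field_simp
        ring
    _ = _ := by
        push_cast [ENNReal.coe_rpow_of_nonneg _ (by positivity : 0 ≤ t)]
        ring

end Muckenhoupt

/-! ### Poincaré and Sobolev–Poincaré inequalities on balls for `C¹` functions. -/

section SmoothSobolev

theorem lintegral_rpow_le_lintegral_rpow {α : Type*} [MeasurableSpace α] {μ : Measure α}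
    [IsProbabilityMeasure μ] {g : α → ℝ≥0∞} (hg : AEMeasurable g μ) {s : ℝ} (hs : 1 ≤ s) :
    (∫⁻ x, g x ∂μ) ^ s ≤ ∫⁻ x, g x ^ s ∂μ := by
  have h := eLpNorm'_le_eLpNorm'_of_exponent_le zero_lt_one hs μ hg.aestronglyMeasurable
  simp only [eLpNorm', enorm_eq_self, ENNReal.rpow_one, div_one] at h
  have := ENNReal.rpow_le_rpow h (by linarith : 0 ≤ s)
  rwa [← ENNReal.rpow_mul, one_div_mul_cancel (by linarith), ENNReal.rpow_one] at this

variable {n : ℕ}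

/-- The fundamental theorem of calculus along the segment, then Jensen on `[0, 1]`. -/
theorem enorm_sub_rpow_le_lintegral_fderiv {u : Rn n → ℝ} (hu : ContDiff ℝ 1 u) {s : ℝ}
    (hs : 1 ≤ s) (x h : Rn n) :
    ‖u (x + h) - u x‖ₑ ^ s ≤
      ‖h‖ₑ ^ s * ∫⁻ t in Icc (0 : ℝ) 1, ‖fderiv ℝ u (x + t • h)‖ₑ ^ s := by
  have hs0 : 0 ≤ s := by linarith
  have hcont : Continuous fun t : ℝ => fderiv ℝ u (x + t • h) :=
    (hu.continuous_fderiv (by norm_num)).comp (by fun_prop)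
  have hprob : IsProbabilityMeasure (volume.restrict (Icc (0 : ℝ) 1)) := ⟨by simp⟩
  have hftc : u (x + h) - u x = ∫ t in (0 : ℝ)..1, fderiv ℝ u (x + t • h) h := by
    have hd : ∀ t ∈ uIcc (0 : ℝ) 1,
        HasDerivAt (fun t : ℝ => u (x + t • h)) (fderiv ℝ u (x + t • h) h) t := by
      intro t _
      have h1 : HasDerivAt (fun t : ℝ => x + t • h) h t := by
        simpa using ((hasDerivAt_id t).smul_const h).const_add x
      exact ((hu.differentiable (by norm_num) _).hasFDerivAt).comp_hasDerivAt t h1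
    rw [intervalIntegral.integral_eq_sub_of_hasDerivAt hd
      ((hcont.clm_apply continuous_const).intervalIntegrable _ _)]
    simp
  have h1 : ‖u (x + h) - u x‖ₑ ≤ ‖h‖ₑ * ∫⁻ t in Icc (0 : ℝ) 1, ‖fderiv ℝ u (x + t • h)‖ₑ := by
    rw [hftc, intervalIntegral.integral_of_le zero_le_one, ← integral_Icc_eq_integral_Ioc]
    refine (enorm_integral_le_lintegral_enorm _).trans ?_
    rw [← lintegral_const_mul' _ _ enorm_ne_top]
    refine lintegral_mono fun t => ?_
    rw [mul_comm]
    exact ContinuousLinearMap.le_opENorm _ _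
  calc ‖u (x + h) - u x‖ₑ ^ s
      ≤ (‖h‖ₑ * ∫⁻ t in Icc (0 : ℝ) 1, ‖fderiv ℝ u (x + t • h)‖ₑ) ^ s := ENNReal.rpow_le_rpow h1 hs0
    _ = ‖h‖ₑ ^ s * (∫⁻ t in Icc (0 : ℝ) 1, ‖fderiv ℝ u (x + t • h)‖ₑ) ^ s :=
        ENNReal.mul_rpow_of_nonneg _ _ hs0
    _ ≤ _ := mul_le_mul_right
        (lintegral_rpow_le_lintegral_rpow hcont.enorm.measurable.aemeasurable hs) _

/-- The Poincaré inequality on balls, in double integral form. -/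
theorem lintegral_lintegral_enorm_sub_rpow_le {u : Rn n → ℝ} (hu : ContDiff ℝ 1 u) {s : ℝ}
    (hs : 1 ≤ s) (c : Rn n) (R : ℝ) :
    ∫⁻ x in Metric.ball c R, ∫⁻ y in Metric.ball c R, ‖u y - u x‖ₑ ^ s ≤
      ENNReal.ofReal (2 * R) ^ s * volume (Metric.ball (0 : Rn n) (2 * R)) *
        ∫⁻ x in Metric.ball c R, ‖fderiv ℝ u x‖ₑ ^ s := by
  have hs0 : 0 ≤ s := by linarith
  set B := Metric.ball c R with hB
  have hBm : MeasurableSet B := Metric.isOpen_ball.measurableSet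
  set g : Rn n → ℝ≥0∞ := B.indicator fun x => ‖fderiv ℝ u x‖ₑ ^ s with hg
  have hgm : Measurable g :=
    ((hu.continuous_fderiv (by norm_num)).enorm.measurable.pow_const _).indicator hBm
  set K : Rn n → ℝ≥0∞ := (Metric.ball (0 : Rn n) (2 * R)).indicator
    fun _ => ENNReal.ofReal (2 * R) ^ s with hK
  have hKm : Measurable K := measurable_const.indicator Metric.isOpen_ball.measurableSet
  -- When both endpoints lie in the ball, so does the segment, by convexity; hence the gradient may
  -- be cut off to `B`.
  have hpt : ∀ x h, B.indicator (fun x => B.indicator (fun y => ‖u y - u x‖ₑ ^ s) (x + h)) x ≤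
      K h * ∫⁻ t in Icc (0 : ℝ) 1, g (x + t • h) := by
    intro x h
    by_cases hx : x ∈ B
    swap
    · rw [indicator_of_notMem hx]; exact zero_le
    by_cases hxh : x + h ∈ B
    swap
    · rw [indicator_of_mem hx, indicator_of_notMem hxh]; exact zero_le
    rw [indicator_of_mem hx, indicator_of_mem hxh]
    have hh : ‖h‖ < 2 * R := by
      have : h = (x + h) - x := by simp
      rw [this, ← dist_eq_norm]
      calc dist (x + h) x ≤ dist (x + h) c + dist x c := dist_triangle_right _ _ _
        _ < R + R := add_lt_add hxh hx
        _ = 2 * R := by ring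
    rw [hK, indicator_of_mem (by simpa using hh)]
    refine (enorm_sub_rpow_le_lintegral_fderiv hu hs x h).trans (mul_le_mul' ?_ (le_of_eq ?_))
    · refine ENNReal.rpow_le_rpow ?_ hs0
      rw [← ofReal_norm]
      exact ENNReal.ofReal_le_ofReal hh.le
    · refine setLIntegral_congr_fun measurableSet_Icc fun t ht => ?_
      have hmem : x + t • h ∈ B := by
        have := (convex_ball c R) hx hxh (sub_nonneg.2 ht.2) ht.1 (by ring)
        convert this using 1
        module
      simp only [hg, indicator_of_mem hmem]
  have hm3 : Measurable fun q : (Rn n × Rn n) × ℝ => g (q.1.1 + q.2 • q.1.2) :=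
    hgm.comp (by fun_prop)
  have hm2 : Measurable fun q : Rn n × Rn n =>
      K q.2 * ∫⁻ t in Icc (0 : ℝ) 1, g (q.1 + t • q.2) :=
    (hKm.comp measurable_snd).mul hm3.lintegral_prod_right'
  calc ∫⁻ x in B, ∫⁻ y in B, ‖u y - u x‖ₑ ^ s
      = ∫⁻ x, ∫⁻ h, B.indicator (fun x => B.indicator (fun y => ‖u y - u x‖ₑ ^ s) (x + h)) x := by
        rw [← lintegral_indicator hBm]
        refine lintegral_congr fun x => ?_
        by_cases hx : x ∈ B
        · simp only [indicator_of_mem hx]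
          rw [← lintegral_indicator hBm, lintegral_add_left_eq_self (μ := (volume : Measure (Rn n)))
            (fun z => B.indicator (fun y => ‖u y - u x‖ₑ ^ s) z) x]
        · simp [indicator_of_notMem hx]
    _ ≤ ∫⁻ x, ∫⁻ h, K h * ∫⁻ t in Icc (0 : ℝ) 1, g (x + t • h) :=
        lintegral_mono fun x => lintegral_mono fun h => hpt x h
    _ = ∫⁻ h, ∫⁻ x, K h * ∫⁻ t in Icc (0 : ℝ) 1, g (x + t • h) :=
        lintegral_lintegral_swap hm2.aemeasurable
    -- For fixed `h` and `t`, translation by `t • h` does not change the integral in `x`.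
    _ = ∫⁻ h, K h * ∫⁻ x, g x := by
        refine lintegral_congr fun h => ?_
        rw [lintegral_const_mul]
        · congr 1
          have hm1 : Measurable fun q : Rn n × ℝ => g (q.1 + q.2 • h) := hgm.comp (by fun_prop)
          rw [lintegral_lintegral_swap hm1.aemeasurable]
          simp_rw [lintegral_add_right_eq_self (μ := (volume : Measure (Rn n))) g]
          simp
        · exact (hgm.comp (by fun_prop : Measurable fun q : Rn n × ℝ =>
            q.1 + q.2 • h)).lintegral_prod_right'
    _ = _ := by
        rw [lintegral_mul_const _ hKm, hK, lintegral_indicator_const Metric.isOpen_ball.measurableSet,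
          hg, lintegral_indicator hBm]

/-- Some `x` in the ball makes the inner integral at most its average, and `a = u x` then serves in
place of the mean. The factor `2 ^ n` is the volume ratio of balls of radii `2R` and `R`. -/
theorem exists_lintegral_enorm_sub_rpow_le {u : Rn n → ℝ} (hu : ContDiff ℝ 1 u) {s : ℝ}
    (hs : 1 ≤ s) (c : Rn n) {R : ℝ} (hR : 0 < R) :
    ∃ a : ℝ, ∫⁻ y in Metric.ball c R, ‖u y - a‖ₑ ^ s ≤
      ENNReal.ofReal (2 * R) ^ s * 2 ^ n * ∫⁻ x in Metric.ball c R, ‖fderiv ℝ u x‖ₑ ^ s := by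
  have hv0 : volume (Metric.ball c R) ≠ 0 := (Metric.measure_ball_pos _ _ hR).ne'
  have hvt : volume (Metric.ball c R) ≠ ⊤ := measure_ball_lt_top.ne
  have hm : Measurable fun x => ∫⁻ y in Metric.ball c R, ‖u y - u x‖ₑ ^ s := by
    have : Measurable fun q : Rn n × Rn n => ‖u q.2 - u q.1‖ₑ ^ s := by
      have h1 := hu.continuous
      exact (Continuous.measurable (by fun_prop)).pow_const _
    exact this.lintegral_prod_right'
  obtain ⟨x, -, hx⟩ := exists_le_setLAverage hv0 hvt hm.aemeasurable
  refine ⟨u x, hx.trans ?_⟩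
  rw [setLAverage_eq]
  refine ENNReal.div_le_of_le_mul ((lintegral_lintegral_enorm_sub_rpow_le hu hs c R).trans ?_)
  rw [Measure.addHaar_ball_mul_of_pos _ _ (by norm_num : (0:ℝ) < 2), finrank_euclideanSpace_fin,
    ENNReal.ofReal_pow (by norm_num), Measure.addHaar_ball_center _ c]
  refine le_of_eq ?_
  norm_num
  ring

theorem eLpNorm_coe_eq {α E : Type*} [MeasurableSpace α] [NormedAddCommGroup E] (f : α → E)
    (μ : Measure α) {s : ℝ≥0} (hs : 1 ≤ s) :
    eLpNorm f s μ = (∫⁻ x, ‖f x‖ₑ ^ (s : ℝ) ∂μ) ^ (1 / (s : ℝ)) := by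
  rw [eLpNorm_eq_lintegral_rpow_enorm_toReal (by simpa using (zero_lt_one.trans_le hs).ne') (by simp)]
  simp

/-- A family of cutoff functions adapted to balls. -/
theorem exists_cutoff (n : ℕ) : ∃ M : ℝ≥0, ∀ (c : Rn n) (r : ℝ), 0 < r → ∃ φ : Rn n → ℝ,
    ContDiff ℝ 1 φ ∧ (∀ x ∈ Metric.ball c r, φ x = 1) ∧ (∀ x, ‖φ x‖ ≤ 1) ∧
    (tsupport φ ⊆ Metric.ball c (2 * r)) ∧ HasCompactSupport φ ∧
    ∀ x, ‖fderiv ℝ φ x‖ ≤ M / r := by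
  -- One bump is rescaled to all balls; an outer radius below 2 keeps the closed support inside the
  -- open ball of radius `2r`.
  set ψ : ContDiffBump (0 : Rn n) := ⟨1, 3 / 2, by norm_num, by norm_num⟩ with hψ
  have hψ1 : ContDiff ℝ 1 ψ := ψ.contDiff
  obtain ⟨M, hM⟩ := (ψ.hasCompactSupport.fderiv (𝕜 := ℝ)).exists_bound_of_continuous
    (hψ1.continuous_fderiv (by norm_num))
  refine ⟨M.toNNReal, fun c r hr => ⟨fun x => ψ (r⁻¹ • (x - c)), ?_, ?_, ?_, ?_, ?_, ?_⟩⟩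
  · exact hψ1.comp (by fun_prop)
  · intro x hx
    refine ψ.one_of_mem_closedBall ?_
    rw [mem_closedBall_zero_iff, norm_smul, norm_inv, Real.norm_of_nonneg hr.le, ← dist_eq_norm]
    change r⁻¹ * dist x c ≤ 1
    rw [inv_mul_le_one₀ hr]
    exact (Metric.mem_ball.1 hx).le
  · intro x
    rw [Real.norm_of_nonneg ψ.nonneg]
    exact ψ.le_one
  · have hsub : tsupport (fun x => ψ (r⁻¹ • (x - c))) ⊆ Metric.closedBall c (3 / 2 * r) := by
      refine closure_minimal ?_ Metric.isClosed_closedBall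
      intro x hx
      have h1 : r⁻¹ • (x - c) ∈ Function.support ψ := hx
      rw [ψ.support_eq, mem_ball_zero_iff, norm_smul, norm_inv, Real.norm_of_nonneg hr.le,
        ← dist_eq_norm, inv_mul_lt_iff₀ hr] at h1
      rw [Metric.mem_closedBall]
      change dist x c < r * (3 / 2) at h1
      linarith
    exact hsub.trans (Metric.closedBall_subset_ball (by linarith))
  · refine HasCompactSupport.of_support_subset_isCompact (isCompact_closedBall c (3 / 2 * r)) ?_
    intro x hx
    have h1 : r⁻¹ • (x - c) ∈ Function.support ψ := hx
    rw [ψ.support_eq, mem_ball_zero_iff, norm_smul, norm_inv, Real.norm_of_nonneg hr.le,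
      ← dist_eq_norm, inv_mul_lt_iff₀ hr] at h1
    rw [Metric.mem_closedBall]
    change dist x c < r * (3 / 2) at h1
    linarith
  · intro x
    have h1 : HasFDerivAt (fun x : Rn n => r⁻¹ • (x - c)) (r⁻¹ • ContinuousLinearMap.id ℝ (Rn n)) x :=
      ((hasFDerivAt_id x).sub_const c).const_smul r⁻¹
    have h2 := ((hψ1.differentiable (by norm_num) (r⁻¹ • (x - c))).hasFDerivAt).comp x h1
    change ‖fderiv ℝ ((ψ : Rn n → ℝ) ∘ fun x => r⁻¹ • (x - c)) x‖ ≤ _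
    rw [h2.fderiv, ContinuousLinearMap.comp_smul, ContinuousLinearMap.comp_id, norm_smul, norm_inv,
      Real.norm_of_nonneg hr.le, inv_mul_eq_div]
    gcongr
    exact (hM _).trans (Real.le_coe_toNNReal M)

/-- The Sobolev–Poincaré inequality on balls for `C¹` functions. -/
theorem exists_eLpNorm_sub_le_fderiv (hn : 0 < n) {s s' : ℝ≥0} (hs : 1 ≤ s)
    (hs' : (s' : ℝ)⁻¹ = (s : ℝ)⁻¹ - (n : ℝ)⁻¹) :
    ∃ C : ℝ≥0, ∀ u : Rn n → ℝ, ContDiff ℝ 1 u → ∀ (c : Rn n) (r : ℝ), 0 < r →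
      ∃ a : ℝ, eLpNorm (fun x => u x - a) s' (volume.restrict (Metric.ball c r)) ≤
        C * eLpNorm (fderiv ℝ u) s (volume.restrict (Metric.ball c (2 * r))) := by
  obtain ⟨M, hM⟩ := exists_cutoff n
  set C₀ := SNormLESNormFDerivOfEqConst ℝ (volume : Measure (Rn n)) s with hC₀
  have hsr : (1 : ℝ) ≤ s := by exact_mod_cast hs
  have hs0 : (0 : ℝ) < s := by linarith
  refine ⟨C₀ * (1 + M * (4 * (2 ^ n) ^ (1 / (s : ℝ)))), fun u hu c r hr => ?_⟩
  obtain ⟨a, ha⟩ := exists_lintegral_enorm_sub_rpow_le hu hsr c (by linarith : 0 < 2 * r)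
  refine ⟨a, ?_⟩
  obtain ⟨φ, hφ, hφ1, hφle, hφs, hφc, hφd⟩ := hM c r hr
  set B := Metric.ball c (2 * r) with hB
  have hBm : MeasurableSet B := Metric.isOpen_ball.measurableSet
  -- Gagliardo–Nirenberg–Sobolev needs compact support, hence the cutoff. The error `(u - a) ∇φ`
  -- carries `M / r`, which cancels the factor `2 · (2r)` of Poincaré on the ball of radius `2r`.
  set v : Rn n → ℝ := fun x => φ x * (u x - a) with hv
  have hua : ContDiff ℝ 1 fun x => u x - a := hu.sub contDiff_const
  have hvC : ContDiff ℝ 1 v := hφ.mul hua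
  have hvc : HasCompactSupport v := hφc.mul_right
  have hgns := eLpNorm_le_eLpNorm_fderiv_of_eq (volume : Measure (Rn n)) hvC hvc hs
    (by rw [finrank_euclideanSpace_fin]; exact hn) (p' := s')
    (by rw [finrank_euclideanSpace_fin]; exact_mod_cast hs')
  have hua2 : eLpNorm (fun x => u x - a) s (volume.restrict B) ≤
      ENNReal.ofReal (2 * (2 * r)) * (2 ^ n) ^ (1 / (s : ℝ)) *
        eLpNorm (fderiv ℝ u) s (volume.restrict B) := by
    rw [eLpNorm_coe_eq _ _ hs, eLpNorm_coe_eq _ _ hs]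
    refine (ENNReal.rpow_le_rpow ha (by positivity)).trans (le_of_eq ?_)
    rw [ENNReal.mul_rpow_of_nonneg _ _ (by positivity), ENNReal.mul_rpow_of_nonneg _ _ (by positivity),
      ← ENNReal.rpow_mul, mul_one_div_cancel hs0.ne', ENNReal.rpow_one]
  have hsupp : Function.support (fderiv ℝ v) ⊆ B :=
    (support_fderiv_subset ℝ).trans ((tsupport_mul_subset_left).trans hφs)
  have hpt : ∀ x, ‖fderiv ℝ v x‖ ≤ ‖fderiv ℝ u x‖ + M / r * ‖u x - a‖ := by
    intro x
    have hd : fderiv ℝ v x = φ x • fderiv ℝ u x + (u x - a) • fderiv ℝ φ x := by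
      have := ((hφ.differentiable (by norm_num) x).hasFDerivAt.mul
        (hua.differentiable (by norm_num) x).hasFDerivAt).fderiv
      rw [fderiv_sub_const] at this
      exact this
    rw [hd]
    refine (norm_add_le _ _).trans ?_
    rw [norm_smul, norm_smul, mul_comm ‖u x - a‖]
    gcongr
    · exact mul_le_of_le_one_left (norm_nonneg _) (hφle x)
    · exact hφd x
  have hs1' : (1 : ℝ≥0∞) ≤ s := by exact_mod_cast hs
  calc eLpNorm (fun x => u x - a) s' (volume.restrict (Metric.ball c r))
      = eLpNorm v s' (volume.restrict (Metric.ball c r)) := by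
        refine eLpNorm_congr_ae ?_
        filter_upwards [ae_restrict_mem Metric.isOpen_ball.measurableSet] with x hx
        simp [hv, hφ1 x hx]
    _ ≤ eLpNorm v s' volume := eLpNorm_mono_measure _ Measure.restrict_le_self
    _ ≤ C₀ * eLpNorm (fderiv ℝ v) s volume := hgns
    _ = C₀ * eLpNorm (fderiv ℝ v) s (volume.restrict B) := by
        have hsupp' : Function.support (fun x => ‖fderiv ℝ v x‖) ⊆ B := fun x hx =>
          hsupp (norm_ne_zero_iff.1 hx)
        rw [← eLpNorm_norm (fderiv ℝ v), ← eLpNorm_norm (fderiv ℝ v),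
          eLpNorm_restrict_eq_of_support_subset hsupp']
    _ ≤ C₀ * eLpNorm (fun x => ‖fderiv ℝ u x‖ + M / r * ‖u x - a‖) s (volume.restrict B) := by
        gcongr
        exact eLpNorm_mono_real hpt
    _ ≤ C₀ * (eLpNorm (fderiv ℝ u) s (volume.restrict B) + ENNReal.ofReal (M / r) *
          eLpNorm (fun x => u x - a) s (volume.restrict B)) := by
        gcongr
        refine (eLpNorm_add_le ?_ ?_ hs1').trans ?_
        · exact (hu.continuous_fderiv (by norm_num)).norm.aestronglyMeasurable
        · exact (continuous_const.mul hua.continuous.norm).aestronglyMeasurable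
        · rw [eLpNorm_norm]
          gcongr
          refine (eLpNorm_const_smul_le (c := (M / r : ℝ)) (f := fun x => ‖u x - a‖)).trans ?_
          rw [eLpNorm_norm, Real.enorm_of_nonneg (by positivity)]
    _ ≤ C₀ * (eLpNorm (fderiv ℝ u) s (volume.restrict B) + ENNReal.ofReal (M / r) *
          (ENNReal.ofReal (2 * (2 * r)) * (2 ^ n) ^ (1 / (s : ℝ)) *
            eLpNorm (fderiv ℝ u) s (volume.restrict B))) := by
        gcongr
    _ = _ := by
        have h4 : ENNReal.ofReal (M / r) * ENNReal.ofReal (2 * (2 * r)) = M * 4 := by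
          rw [← ENNReal.ofReal_mul (by positivity)]
          have : (M : ℝ) / r * (2 * (2 * r)) = M * 4 := by field_simp; ring
          rw [this, ENNReal.ofReal_mul (by positivity)]
          simp
        push_cast [ENNReal.coe_rpow_of_nonneg _ (by positivity : 0 ≤ 1 / (s : ℝ))]
        rw [← mul_assoc, ← mul_assoc (ENNReal.ofReal _), h4]
        ring

end SmoothSobolev

/-! ### Sobolev–Poincaré for weak gradients, by mollification. -/

section WeakSobolev

open scoped Convolution

variable {n : ℕ}

/-- The mollification of `f` by a normed bump function. -/
noncomputable def mollify (φ : ContDiffBump (0 : Rn n)) (f : Rn n → ℝ) : Rn n → ℝ :=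
  φ.normed volume ⋆[ContinuousLinearMap.lsmul ℝ ℝ, volume] f

theorem mollify_eq (φ : ContDiffBump (0 : Rn n)) (f : Rn n → ℝ) :
    mollify φ f = f ⋆[(ContinuousLinearMap.lsmul ℝ ℝ).flip, volume] φ.normed volume := by
  rw [mollify, ← convolution_flip]

theorem contDiff_mollify (φ : ContDiffBump (0 : Rn n)) {f : Rn n → ℝ}
    (hf : LocallyIntegrable f volume) : ContDiff ℝ 1 (mollify φ f) := by
  rw [mollify_eq]
  exact φ.hasCompactSupport_normed.contDiff_convolution_right _ hf (n := 1) φ.contDiff_normed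

/-- The reflected, translated bump is a test function; the sign from `y ↦ x - y` cancels the one in
the definition of the weak gradient. -/
theorem fderiv_mollify_apply (φ : ContDiffBump (0 : Rn n)) {f : Rn n → ℝ} {G : Rn n → Rn n}
    (h : IsWeakGradient f G) (x v : Rn n) :
    fderiv ℝ (mollify φ f) x v = ∫ y, φ.normed volume (x - y) * inner ℝ (G y) v := by
  have hη : ContDiff ℝ 1 (φ.normed (volume : Measure (Rn n))) := φ.contDiff_normed
  have hηc : HasCompactSupport (φ.normed (volume : Measure (Rn n))) := φ.hasCompactSupport_normed
  have hder := hηc.hasFDerivAt_convolution_right (ContinuousLinearMap.lsmul ℝ ℝ).flip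
    h.locallyIntegrable hη x
  rw [mollify_eq, hder.fderiv, convolution_precompR_apply _ h.locallyIntegrable
    (hηc.fderiv (𝕜 := ℝ)) (hη.continuous_fderiv (by norm_num))]
  set ψ : Rn n → ℝ := fun y => φ.normed volume (x - y) with hψ
  have hψd : ContDiff ℝ ∞ ψ := by
    have : ContDiff ℝ ∞ (φ.normed (volume : Measure (Rn n))) := φ.contDiff_normed
    exact this.comp (contDiff_const.sub contDiff_id)
  have hψc : HasCompactSupport ψ := hηc.comp_homeomorph (Homeomorph.subLeft x)
  have hfd : ∀ y, fderiv ℝ ψ y v = - fderiv ℝ (φ.normed (volume : Measure (Rn n))) (x - y) v := by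
    intro y
    have h1 : HasFDerivAt (fun y : Rn n => x - y) (-ContinuousLinearMap.id ℝ (Rn n)) y :=
      (hasFDerivAt_id y).const_sub x
    have h2 := ((hη.differentiable (by norm_num) (x - y)).hasFDerivAt).comp y h1
    change fderiv ℝ (φ.normed (volume : Measure (Rn n)) ∘ fun y => x - y) y v = _
    rw [h2.fderiv]; simp
  have key := h.integral_eq ψ hψd hψc v
  simp_rw [hfd, mul_neg, integral_neg, neg_inj] at key
  rw [← key, convolution_def]
  refine integral_congr_ae (Eventually.of_forall fun y => ?_)
  simp [mul_comm]

theorem enorm_fderiv_mollify_le (φ : ContDiffBump (0 : Rn n)) {f : Rn n → ℝ} {G : Rn n → Rn n}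
    (h : IsWeakGradient f G) (x : Rn n) :
    ‖fderiv ℝ (mollify φ f) x‖ₑ ≤
      ∫⁻ y, ENNReal.ofReal (φ.normed volume (x - y)) * ‖G y‖ₑ := by
  refine ContinuousLinearMap.opENorm_le_bound _ fun v => ?_
  rw [fderiv_mollify_apply φ h]
  refine (enorm_integral_le_lintegral_enorm _).trans ?_
  rw [← lintegral_mul_const' _ _ enorm_ne_top]
  refine lintegral_mono fun y => ?_
  rw [enorm_mul, Real.enorm_of_nonneg (φ.nonneg_normed _), mul_assoc]
  gcongr
  rw [← ofReal_norm, ← ofReal_norm, ← ofReal_norm, ← ENNReal.ofReal_mul (norm_nonneg _)]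
  exact ENNReal.ofReal_le_ofReal (norm_inner_le_norm _ _)

/-- The bump is a probability density, so Jensen and Tonelli apply; its support costs an enlargement
of the ball by `φ.rOut`. -/
theorem lintegral_fderiv_mollify_rpow_le (φ : ContDiffBump (0 : Rn n)) {f : Rn n → ℝ}
    {G : Rn n → Rn n} (h : IsWeakGradient f G) {s : ℝ} (hs : 1 ≤ s) (c : Rn n) (r : ℝ) :
    ∫⁻ x in Metric.ball c r, ‖fderiv ℝ (mollify φ f) x‖ₑ ^ s ≤
      ∫⁻ x in Metric.ball c (r + φ.rOut), ‖G x‖ₑ ^ s := by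
  have hGm : AEMeasurable (fun x => ‖G x‖ₑ) := h.locallyIntegrable_grad.aestronglyMeasurable.enorm
  set g := hGm.mk with hg
  have hgm : Measurable g := hGm.measurable_mk
  have hgG : (fun x => ‖G x‖ₑ) =ᵐ[volume] g := hGm.ae_eq_mk
  set η : Rn n → ℝ≥0∞ := fun t => ENNReal.ofReal (φ.normed volume t) with hη
  have hηm : Measurable η := φ.continuous_normed.measurable.ennreal_ofReal
  set ν : Measure (Rn n) := volume.withDensity η with hν
  have hprob : IsProbabilityMeasure ν := ⟨by
    rw [hν, withDensity_apply _ MeasurableSet.univ, setLIntegral_univ,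
      ← ofReal_integral_eq_lintegral_ofReal φ.integrable_normed
        (Eventually.of_forall φ.nonneg_normed), φ.integral_normed, ENNReal.ofReal_one]⟩
  have hsupp : ∀ᵐ t ∂ν, t ∈ Metric.ball (0 : Rn n) φ.rOut := by
    rw [hν, ae_withDensity_iff hηm]
    refine Eventually.of_forall fun t ht => ?_
    rw [← φ.support_normed_eq (μ := volume), Function.mem_support]
    intro h0
    simp [hη, h0] at ht
  have hpt : ∀ x, ‖fderiv ℝ (mollify φ f) x‖ₑ ^ s ≤ ∫⁻ t, g (x - t) ^ s ∂ν := by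
    intro x
    refine le_trans (ENNReal.rpow_le_rpow (enorm_fderiv_mollify_le φ h x) (by linarith)) ?_
    have h1 : ∫⁻ y, ENNReal.ofReal (φ.normed volume (x - y)) * ‖G y‖ₑ = ∫⁻ t, g (x - t) ∂ν := by
      rw [hν, lintegral_withDensity_eq_lintegral_mul _ hηm (by fun_prop)]
      calc ∫⁻ y, ENNReal.ofReal (φ.normed volume (x - y)) * ‖G y‖ₑ
          = ∫⁻ y, η (x - y) * g y := by
            refine lintegral_congr_ae ?_
            filter_upwards [hgG] with y hy
            rw [hη, ← hy]
        _ = ∫⁻ t, η (x - (x - t)) * g (x - t) :=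
            (lintegral_sub_left_eq_self (μ := (volume : Measure (Rn n)))
              (fun y => η (x - y) * g y) x).symm
        _ = _ := by simp
    rw [h1]
    exact lintegral_rpow_le_lintegral_rpow (by fun_prop) hs
  have hgs : Measurable fun x => g x ^ s := hgm.pow_const _
  calc ∫⁻ x in Metric.ball c r, ‖fderiv ℝ (mollify φ f) x‖ₑ ^ s
      ≤ ∫⁻ x in Metric.ball c r, ∫⁻ t, g (x - t) ^ s ∂ν := lintegral_mono hpt
    _ = ∫⁻ t, (∫⁻ x in Metric.ball c r, g (x - t) ^ s) ∂ν :=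
        lintegral_lintegral_swap
          (hgs.comp (by fun_prop : Measurable fun q : Rn n × Rn n => q.1 - q.2)).aemeasurable
    _ ≤ ∫⁻ _t, (∫⁻ x in Metric.ball c (r + φ.rOut), g x ^ s) ∂ν := by
        refine lintegral_mono_ae ?_
        filter_upwards [hsupp] with t ht
        rw [← lintegral_indicator Metric.isOpen_ball.measurableSet,
          ← lintegral_indicator Metric.isOpen_ball.measurableSet,
          ← lintegral_sub_right_eq_self (μ := (volume : Measure (Rn n)))
            ((Metric.ball c (r + φ.rOut)).indicator fun x => g x ^ s) t]
        refine lintegral_mono fun x => ?_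
        by_cases hx : x ∈ Metric.ball c r
        · have hxt : x - t ∈ Metric.ball c (r + φ.rOut) := by
            rw [mem_ball_zero_iff] at ht
            rw [mem_ball_iff_norm] at hx ⊢
            calc ‖x - t - c‖ = ‖(x - c) - t‖ := by congr 1; abel
              _ ≤ ‖x - c‖ + ‖t‖ := norm_sub_le _ _
              _ < _ := add_lt_add hx ht
          rw [indicator_of_mem hx, indicator_of_mem hxt]
        · rw [indicator_of_notMem hx]; exact zero_le
    _ = ∫⁻ x in Metric.ball c (r + φ.rOut), g x ^ s := by simp
    _ = _ := by
        refine lintegral_congr_ae (ae_restrict_of_ae ?_)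
        filter_upwards [hgG] with x hx
        rw [← hx]

/-- The Sobolev–Poincaré inequality on balls for functions with a weak gradient. -/
theorem exists_eLpNorm_sub_le_weakGradient (hn : 0 < n) {s s' : ℝ≥0} (hs : 1 ≤ s) (hs1 : 1 ≤ s')
    (hs' : (s' : ℝ)⁻¹ = (s : ℝ)⁻¹ - (n : ℝ)⁻¹) :
    ∃ C : ℝ≥0, ∀ (f : Rn n → ℝ) (G : Rn n → Rn n), IsWeakGradient f G →
      ∀ (c : Rn n) (r : ℝ), 0 < r →
      ∃ a : ℝ, eLpNorm (fun x => f x - a) s' (volume.restrict (Metric.ball c r)) ≤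
        C * eLpNorm G s (volume.restrict (Metric.ball c (3 * r))) := by
  obtain ⟨C, hC⟩ := exists_eLpNorm_sub_le_fderiv hn hs hs'
  have hsr : (1 : ℝ) ≤ s := by exact_mod_cast hs
  have hsr' : (1 : ℝ) ≤ s' := by exact_mod_cast hs1
  have hs0' : (0 : ℝ) < s' := by linarith
  refine ⟨2 * C, fun f G hfG c r hr => ?_⟩
  set B := Metric.ball c r with hB
  have hBm : MeasurableSet B := Metric.isOpen_ball.measurableSet
  have hv0 : volume B ≠ 0 := (Metric.measure_ball_pos _ _ hr).ne'
  have hvt : volume B ≠ ⊤ := measure_ball_lt_top.ne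
  set T := C * eLpNorm G s (volume.restrict (Metric.ball c (3 * r))) with hT
  -- The outer radii tend to 0 and stay at most `r`, so `2r` grows to at most `3r`; the fixed ratio
  -- 2 of the radii is what almost everywhere convergence requires.
  set φ : ℕ → ContDiffBump (0 : Rn n) := fun k =>
    ⟨r / (k + 1) / 2, r / (k + 1), by positivity, half_lt_self (by positivity)⟩ with hφ
  have hφr : ∀ k, (φ k).rOut ≤ r := fun k => by
    change r / (k + 1) ≤ r
    exact div_le_self hr.le (by linarith [(Nat.cast_nonneg k : (0:ℝ) ≤ k)])
  have hconv : ∀ᵐ x, Tendsto (fun k => mollify (φ k) f x) atTop (𝓝 (f x)) := by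
    refine ContDiffBump.ae_convolution_tendsto_right_of_locallyIntegrable (K := 2) ?_ ?_
      hfG.locallyIntegrable
    · exact tendsto_const_div_atTop_nhds_zero_nat r |>.comp (tendsto_add_atTop_nat 1) |>.congr
        fun k => by simp [hφ]
    · refine Eventually.of_forall fun k => ?_
      change r / (k + 1) ≤ 2 * (r / (k + 1) / 2)
      linarith
  set u : ℕ → Rn n → ℝ := fun k => mollify (φ k) f with hu
  have huC : ∀ k, ContDiff ℝ 1 (u k) := fun k => contDiff_mollify (φ k) hfG.locallyIntegrable
  have hbound : ∀ k, ∃ a : ℝ, ∫⁻ x in B, ‖u k x - a‖ₑ ^ (s' : ℝ) ≤ T ^ (s' : ℝ) := by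
    intro k
    obtain ⟨a, ha⟩ := hC (u k) (huC k) c r hr
    refine ⟨a, ?_⟩
    have h1 : eLpNorm (fderiv ℝ (u k)) s (volume.restrict (Metric.ball c (2 * r))) ≤
        eLpNorm G s (volume.restrict (Metric.ball c (3 * r))) := by
      rw [eLpNorm_coe_eq _ _ hs, eLpNorm_coe_eq _ _ hs]
      refine ENNReal.rpow_le_rpow ((lintegral_fderiv_mollify_rpow_le (φ k) hfG hsr c _).trans ?_)
        (by positivity)
      exact lintegral_mono_set (Metric.ball_subset_ball (by linarith [hφr k]))
    have h2 := ENNReal.rpow_le_rpow (ha.trans (mul_le_mul_right h1 _)) hs0'.le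
    rwa [eLpNorm_coe_eq _ _ hs1, ← ENNReal.rpow_mul, one_div_mul_cancel hs0'.ne',
      ENNReal.rpow_one] at h2
  have hmeas : ∀ k, Measurable fun x => ∫⁻ y in B, ‖u k y - u k x‖ₑ ^ (s' : ℝ) := by
    intro k
    have h0 := (huC k).continuous
    have : Measurable fun q : Rn n × Rn n => ‖u k q.2 - u k q.1‖ₑ ^ (s' : ℝ) :=
      (Continuous.measurable (by fun_prop)).pow_const _
    exact this.lintegral_prod_right'
  -- The constants supplied by `hbound` vary with `k` without known convergence; the double integral
  -- of differences eliminates them.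
  have hdouble : ∀ k, ∫⁻ x in B, ∫⁻ y in B, ‖u k y - u k x‖ₑ ^ (s' : ℝ) ≤
      2 ^ (s' : ℝ) * T ^ (s' : ℝ) * volume B := by
    intro k
    obtain ⟨a, ha⟩ := hbound k
    have hum : Measurable fun x => ‖u k x - a‖ₑ ^ (s' : ℝ) := by
      have h0 := (huC k).continuous
      exact (Continuous.measurable (by fun_prop)).pow_const _
    have hpt : ∀ x y, ‖u k y - u k x‖ₑ ^ (s' : ℝ) ≤ 2 ^ ((s' : ℝ) - 1) *
        (‖u k y - a‖ₑ ^ (s' : ℝ) + ‖u k x - a‖ₑ ^ (s' : ℝ)) := by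
      intro x y
      refine le_trans (ENNReal.rpow_le_rpow ?_ hs0'.le)
        (ENNReal.rpow_add_le_mul_rpow_add_rpow _ _ hsr')
      have : u k y - u k x = (u k y - a) - (u k x - a) := by ring
      rw [this]
      exact enorm_sub_le
    calc _ ≤ ∫⁻ x in B, ∫⁻ y in B, 2 ^ ((s' : ℝ) - 1) *
        (‖u k y - a‖ₑ ^ (s' : ℝ) + ‖u k x - a‖ₑ ^ (s' : ℝ)) :=
          lintegral_mono fun x => lintegral_mono fun y => hpt x y
      _ = 2 ^ ((s' : ℝ) - 1) * (2 * ((∫⁻ x in B, ‖u k x - a‖ₑ ^ (s' : ℝ)) * volume B)) := by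
          have h2t : (2 : ℝ≥0∞) ^ ((s' : ℝ) - 1) ≠ ⊤ :=
            ENNReal.rpow_ne_top_of_nonneg (by linarith) (by norm_num)
          simp_rw [lintegral_const_mul' _ _ h2t, lintegral_add_left hum, setLIntegral_const]
          rw [lintegral_add_left measurable_const, setLIntegral_const,
            lintegral_mul_const _ hum]
          ring
      _ ≤ 2 ^ ((s' : ℝ) - 1) * (2 * (T ^ (s' : ℝ) * volume B)) := by gcongr
      _ = _ := by
          rw [ENNReal.rpow_sub _ _ (by norm_num) (by norm_num), ENNReal.rpow_one, ← mul_assoc,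
            ENNReal.div_mul_cancel (by norm_num) (by norm_num), mul_assoc]
  set Φ : Rn n → ℝ≥0∞ := fun x => liminf (fun k => ∫⁻ y in B, ‖u k y - u k x‖ₑ ^ (s' : ℝ)) atTop
    with hΦ
  have hΦm : Measurable Φ := Measurable.liminf hmeas
  have hΦle : ∫⁻ x in B, Φ x ≤ 2 ^ (s' : ℝ) * T ^ (s' : ℝ) * volume B := by
    refine (lintegral_liminf_le hmeas).trans ?_
    refine liminf_le_of_le (by isBoundedDefault) fun b hb => ?_
    obtain ⟨k, hk⟩ := hb.exists
    exact hk.trans (hdouble k)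
  have hne : volume.restrict B ≠ 0 := by
    rw [Ne, Measure.restrict_eq_zero]; exact hv0
  have hfin : IsFiniteMeasure (volume.restrict B) := ⟨by simpa using hvt.lt_top⟩
  -- After Fatou in `x`, pick a point where `Φ` is at most its average and the mollifications
  -- converge. A second Fatou, in `y`, then allows the constant `f x`.
  obtain ⟨x, hx, hxle⟩ := exists_notMem_null_le_laverage hne hΦm.aemeasurable
    (ae_restrict_of_ae hconv : ∀ᵐ x ∂volume.restrict B, _)
  replace hx : Tendsto (fun k => u k x) atTop (𝓝 (f x)) := by simpa using hx
  have hxle' : Φ x ≤ (2 * T) ^ (s' : ℝ) := by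
    refine hxle.trans ?_
    rw [setLAverage_eq, ENNReal.mul_rpow_of_nonneg _ _ hs0'.le]
    exact ENNReal.div_le_of_le_mul hΦle
  refine ⟨f x, ?_⟩
  have hfat : ∫⁻ y in B, ‖f y - f x‖ₑ ^ (s' : ℝ) ≤ Φ x := by
    calc ∫⁻ y in B, ‖f y - f x‖ₑ ^ (s' : ℝ)
        = ∫⁻ y in B, liminf (fun k => ‖u k y - u k x‖ₑ ^ (s' : ℝ)) atTop := by
          refine lintegral_congr_ae (ae_restrict_of_ae ?_)
          filter_upwards [hconv] with y hy
          exact (((hy.sub hx).enorm).ennrpow_const _).liminf_eq.symm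
      _ ≤ Φ x := lintegral_liminf_le fun k => by
          have h0 := (huC k).continuous
          exact (Continuous.measurable (by fun_prop)).pow_const _
  rw [eLpNorm_coe_eq _ _ hs1, ENNReal.coe_mul, mul_assoc]
  calc _ ≤ ((2 * T) ^ (s' : ℝ)) ^ (1 / (s' : ℝ)) :=
        ENNReal.rpow_le_rpow (hfat.trans hxle') (by positivity)
    _ = _ := by
        rw [← ENNReal.rpow_mul, mul_one_div_cancel hs0'.ne', ENNReal.rpow_one]
        rfl

end WeakSobolev

/-! ### The rough kernel in polar coordinates. -/

section Polar

variable {n : ℕ}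

/-- The annulus `a ≤ |y| < 2a`. -/
def annulus (n : ℕ) (a : ℝ) : Set (Rn n) := {y | a ≤ ‖y‖ ∧ ‖y‖ < 2 * a}

theorem measurableSet_annulus (a : ℝ) : MeasurableSet (annulus n a) :=
  (measurableSet_le measurable_const measurable_norm).inter
    (measurableSet_lt measurable_norm measurable_const)

theorem annulus_subset_ball (a : ℝ) : annulus n a ⊆ Metric.ball 0 (2 * a) := fun y hy => by
  simpa using hy.2

theorem volume_annulus_lt_top (a : ℝ) : volume (annulus n a) < ⊤ :=
  (measure_mono (annulus_subset_ball a)).trans_lt measure_ball_lt_top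

theorem roughKernel_eq (Ω : UnitSphere n → ℝ) (x : ({0}ᶜ : Set (Rn n))) :
    roughKernel Ω x = Ω (homeomorphUnitSphereProd (Rn n) x).1 / ‖(x : Rn n)‖ ^ n := by
  have hx : (x : Rn n) ≠ 0 := x.2
  rw [roughKernel, dif_neg hx]
  congr 2
  exact Subtype.ext (homeomorphUnitSphereProd_apply_fst_coe (Rn n) x).symm

theorem measurable_roughKernel {Ω : UnitSphere n → ℝ} (hΩ : Measurable Ω) :
    Measurable (roughKernel Ω) := by
  classical
  have h : roughKernel Ω = fun y : Rn n => if hy : y ∈ ({0} : Set (Rn n)) then (0 : ℝ) else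
      Ω (homeomorphUnitSphereProd (Rn n) ⟨y, hy⟩).1 / ‖y‖ ^ n := by
    ext y
    by_cases hy : y = 0
    · simp [roughKernel, hy]
    · have := roughKernel_eq Ω ⟨y, hy⟩
      simp only at this
      rw [this, dif_neg (by simpa using hy)]
  rw [h]
  refine Measurable.dite (s := ({0} : Set (Rn n))) (f := fun _ => (0 : ℝ))
    (g := fun x => Ω (homeomorphUnitSphereProd (Rn n) x).1 / ‖(x : Rn n)‖ ^ n)
    measurable_const ?_ (measurableSet_singleton 0)
  have h1 : Measurable fun x : ({0}ᶜ : Set (Rn n)) => (homeomorphUnitSphereProd (Rn n) x).1 :=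
    measurable_fst.comp (homeomorphUnitSphereProd (Rn n)).measurable
  exact (hΩ.comp h1).div (measurable_subtype_coe.norm.pow_const n)

/-- Null sets of directions become null cones under polar coordinates, and the origin is negligible.
-/
theorem roughKernel_congr_ae (hn : 0 < n) {Ω Ω' : UnitSphere n → ℝ}
    (h : Ω =ᵐ[surfaceMeasure n] Ω') : roughKernel Ω =ᵐ[volume] roughKernel Ω' := by
  have : Nonempty (Fin n) := ⟨⟨0, hn⟩⟩
  have h1 : ∀ᵐ q ∂((surfaceMeasure n).prod (Measure.volumeIoiPow (Module.finrank ℝ (Rn n) - 1))),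
      Ω q.1 = Ω' q.1 := Measure.quasiMeasurePreserving_fst.ae h
  have h2 := (volume : Measure (Rn n)).measurePreserving_homeomorphUnitSphereProd
    |>.quasiMeasurePreserving.ae h1
  have h3 : ∀ᵐ y ∂(volume.restrict ({0}ᶜ : Set (Rn n))), roughKernel Ω y = roughKernel Ω' y := by
    rw [← map_comap_subtype_coe (measurableSet_singleton 0).compl,
      (MeasurableEmbedding.subtype_coe (measurableSet_singleton (0 : Rn n)).compl).ae_map_iff]
    filter_upwards [h2] with x hx
    rw [roughKernel_eq, roughKernel_eq, hx]
  rwa [restrict_compl_singleton] at h3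

theorem aestronglyMeasurable_roughKernel (hn : 0 < n) {Ω : UnitSphere n → ℝ}
    (hΩ : AEStronglyMeasurable Ω (surfaceMeasure n)) :
    AEStronglyMeasurable (roughKernel Ω) volume :=
  ⟨_, (measurable_roughKernel hΩ.stronglyMeasurable_mk.measurable).stronglyMeasurable,
    roughKernel_congr_ae hn hΩ.ae_eq_mk⟩

/-- On the annulus `|y|^(-n) ≤ a^(-n)`. The radial factor is then enlarged to `(0, 2a)`, of mass
`(2a)^n / n ≤ (2a)^n`. -/
theorem lintegral_roughKernel_rpow_le (hn : 0 < n) {Ω : UnitSphere n → ℝ}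
    (hΩ : AEStronglyMeasurable Ω (surfaceMeasure n)) {ρ : ℝ} (hρ : 0 ≤ ρ) {a : ℝ} (ha : 0 < a) :
    ∫⁻ y in annulus n a, ‖roughKernel Ω y‖ₑ ^ ρ ≤
      ENNReal.ofReal a⁻¹ ^ (n * ρ) * ENNReal.ofReal (2 * a) ^ (n : ℝ) *
        ∫⁻ θ, ‖Ω θ‖ₑ ^ ρ ∂(surfaceMeasure n) := by
  have : Nonempty (Fin n) := ⟨⟨0, hn⟩⟩
  set e := homeomorphUnitSphereProd (Rn n) with he
  set b : Ioi (0 : ℝ) := ⟨2 * a, by rw [mem_Ioi]; linarith⟩ with hb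
  set K : ℝ≥0∞ := ENNReal.ofReal a⁻¹ ^ (n * ρ) with hK
  have hΩm : AEMeasurable (fun θ => K * ‖Ω θ‖ₑ ^ ρ) (surfaceMeasure n) :=
    (hΩ.enorm.pow_const _).const_mul _
  have hKt : K ≠ ⊤ := ENNReal.rpow_ne_top_of_nonneg (by positivity) ENNReal.ofReal_ne_top
  calc ∫⁻ y in annulus n a, ‖roughKernel Ω y‖ₑ ^ ρ
      = ∫⁻ y in ({0}ᶜ : Set (Rn n)), (annulus n a).indicator (fun y => ‖roughKernel Ω y‖ₑ ^ ρ) y := by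
        rw [restrict_compl_singleton, lintegral_indicator (measurableSet_annulus a)]
    _ = ∫⁻ x : ({0}ᶜ : Set (Rn n)), (annulus n a).indicator (fun y => ‖roughKernel Ω y‖ₑ ^ ρ) x
          ∂(volume.comap Subtype.val) :=
        (lintegral_subtype_comap (measurableSet_singleton _).compl _).symm
    _ ≤ ∫⁻ x : ({0}ᶜ : Set (Rn n)), (fun q : UnitSphere n × Ioi (0 : ℝ) =>
          (K * ‖Ω q.1‖ₑ ^ ρ) * (Iio b).indicator 1 q.2) (e x) ∂(volume.comap Subtype.val) := by
        refine lintegral_mono fun x => ?_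
        by_cases hx : (x : Rn n) ∈ annulus n a
        swap
        · rw [indicator_of_notMem hx]; exact zero_le
        have hxb : (e x).2 ∈ Iio b := by
          rw [mem_Iio, ← Subtype.coe_lt_coe, he, homeomorphUnitSphereProd_apply_snd_coe]
          exact hx.2
        have hx0 : 0 < ‖(x : Rn n)‖ := ha.trans_le hx.1
        simp only
        rw [indicator_of_mem hx, indicator_of_mem hxb, Pi.one_apply, mul_one, roughKernel_eq,
          div_eq_inv_mul, enorm_mul, ENNReal.mul_rpow_of_nonneg _ _ hρ]
        refine mul_le_mul_left ?_ _
        rw [hK, ENNReal.rpow_mul, ENNReal.rpow_natCast]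
        refine ENNReal.rpow_le_rpow ?_ hρ
        rw [Real.enorm_of_nonneg (by positivity), ← ENNReal.ofReal_pow (by positivity), inv_pow]
        refine ENNReal.ofReal_le_ofReal ?_
        gcongr
        exact hx.1
    _ = ∫⁻ q, (K * ‖Ω q.1‖ₑ ^ ρ) * (Iio b).indicator 1 q.2
          ∂((surfaceMeasure n).prod (Measure.volumeIoiPow (Module.finrank ℝ (Rn n) - 1))) :=
        (volume : Measure (Rn n)).measurePreserving_homeomorphUnitSphereProd.lintegral_comp_emb
          e.measurableEmbedding (fun q : UnitSphere n × Ioi (0 : ℝ) =>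
            (K * ‖Ω q.1‖ₑ ^ ρ) * (Iio b).indicator 1 q.2)
    _ = (K * ∫⁻ θ, ‖Ω θ‖ₑ ^ ρ ∂(surfaceMeasure n)) *
          Measure.volumeIoiPow (Module.finrank ℝ (Rn n) - 1) (Iio b) := by
        rw [lintegral_prod_mul hΩm (measurable_one.indicator measurableSet_Iio).aemeasurable,
          lintegral_const_mul' _ _ hKt, lintegral_indicator_one measurableSet_Iio]
    _ ≤ (K * ∫⁻ θ, ‖Ω θ‖ₑ ^ ρ ∂(surfaceMeasure n)) * ENNReal.ofReal (2 * a) ^ (n : ℝ) := by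
        refine mul_le_mul_right ?_ _
        have hn1 : ((n - 1 : ℕ) : ℝ) + 1 = n := by
          rw [Nat.cast_sub hn]; simp
        rw [Measure.volumeIoiPow_apply_Iio, finrank_euclideanSpace_fin, Nat.sub_add_cancel hn, hn1,
          ENNReal.rpow_natCast, ← ENNReal.ofReal_pow (by positivity)]
        refine ENNReal.ofReal_le_ofReal (div_le_self (by positivity) ?_)
        exact_mod_cast hn
    _ = _ := by ring

/-- In polar coordinates the integral factors, with `∫ Ω = 0` as one factor. Arbitrary radial sets
are allowed so that truncated annuli are covered. -/
theorem setIntegral_roughKernel_eq_zero (hn : 0 < n) {Ω : UnitSphere n → ℝ}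
    (hΩ : ∫ θ, Ω θ ∂(surfaceMeasure n) = 0) {I : Set ℝ} (hI : MeasurableSet I) :
    ∫ y in {y : Rn n | ‖y‖ ∈ I}, roughKernel Ω y = 0 := by
  have : Nonempty (Fin n) := ⟨⟨0, hn⟩⟩
  set e := homeomorphUnitSphereProd (Rn n) with he
  have hm : MeasurableSet {y : Rn n | ‖y‖ ∈ I} := measurable_norm hI
  calc ∫ y in {y : Rn n | ‖y‖ ∈ I}, roughKernel Ω y
      = ∫ y in ({0}ᶜ : Set (Rn n)), {y : Rn n | ‖y‖ ∈ I}.indicator (roughKernel Ω) y := by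
        rw [restrict_compl_singleton, integral_indicator hm]
    _ = ∫ x : ({0}ᶜ : Set (Rn n)), {y : Rn n | ‖y‖ ∈ I}.indicator (roughKernel Ω) x
          ∂(volume.comap Subtype.val) :=
        (integral_subtype_comap (measurableSet_singleton _).compl _).symm
    _ = ∫ x : ({0}ᶜ : Set (Rn n)), (fun q : UnitSphere n × Ioi (0 : ℝ) =>
          Ω q.1 * I.indicator (fun r => (r ^ n)⁻¹) (q.2 : ℝ)) (e x) ∂(volume.comap Subtype.val) := by
        refine integral_congr_ae (Eventually.of_forall fun x => ?_)
        simp only [he, homeomorphUnitSphereProd_apply_snd_coe]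
        by_cases hx : ‖(x : Rn n)‖ ∈ I
        · rw [indicator_of_mem (show (x : Rn n) ∈ {y : Rn n | ‖y‖ ∈ I} from hx),
            indicator_of_mem hx, roughKernel_eq, div_eq_mul_inv]
        · rw [indicator_of_notMem (show (x : Rn n) ∉ {y : Rn n | ‖y‖ ∈ I} from hx),
            indicator_of_notMem hx, mul_zero]
    _ = ∫ q, Ω q.1 * I.indicator (fun r => (r ^ n)⁻¹) (q.2 : ℝ)
          ∂((surfaceMeasure n).prod (Measure.volumeIoiPow (Module.finrank ℝ (Rn n) - 1))) :=
        (volume : Measure (Rn n)).measurePreserving_homeomorphUnitSphereProd.integral_comp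
          e.measurableEmbedding (fun q : UnitSphere n × Ioi (0 : ℝ) =>
            Ω q.1 * I.indicator (fun r => (r ^ n)⁻¹) (q.2 : ℝ))
    _ = 0 := by
        rw [integral_prod_mul Ω (fun r : Ioi (0 : ℝ) => I.indicator (fun r => (r ^ n)⁻¹) (r : ℝ)),
          hΩ, zero_mul]

end Polar

/-! ### Estimates on dyadic annuli and their summation. -/

section Annuli

variable {n : ℕ}

theorem volume_ball_eq (hn : 0 < n) (x : Rn n) {r : ℝ} (hr : 0 < r) :
    volume (Metric.ball x r) =
      ENNReal.ofReal r ^ (n : ℝ) * volume (Metric.ball (0 : Rn n) 1) := by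
  have : Nonempty (Fin n) := ⟨⟨0, hn⟩⟩
  rw [Measure.addHaar_ball _ _ hr.le, finrank_euclideanSpace_fin, ENNReal.rpow_natCast,
    ENNReal.ofReal_pow hr.le]

/-- The oscillation estimate on a single annulus. -/
theorem exists_lintegral_annulus_le (hn : 0 < n) {ρ α : ℝ} (hρ : 1 < ρ) (hρn : ρ < n)
    (hα : ρ * n / (ρ * n + ρ - n) ≤ α) :
    ∃ C : ℝ≥0, ∀ Ω : UnitSphere n → ℝ, AEStronglyMeasurable Ω (surfaceMeasure n) →
      ∀ (f : Rn n → ℝ) (G : Rn n → Rn n), IsWeakGradient f G → ∀ (x : Rn n) (a : ℝ), 0 < a →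
      ∃ c : ℝ, ∫⁻ y in annulus n a, ‖roughKernel Ω y‖ₑ * ‖f (x - y) - c‖ₑ ≤
        C * eLpNorm Ω (ENNReal.ofReal ρ) (surfaceMeasure n) * (ENNReal.ofReal a *
          (⨍⁻ z in Metric.ball x (6 * a), ‖G z‖ₑ ^ α ∂volume) ^ (1 / α)) := by
  have hnr : (0 : ℝ) < n := by exact_mod_cast hn
  have hρ0 : 0 < ρ := by linarith
  have hD : 0 < ρ * n + ρ - n := by nlinarith
  -- Chosen so that its Sobolev conjugate is `s' = ρ/(ρ-1)`, the Hölder conjugate of `ρ`; `ρ < n`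
  -- gives `s ≥ 1`.
  set s : ℝ := ρ * n / (ρ * n + ρ - n) with hs
  set s' : ℝ := ρ / (ρ - 1) with hs'
  have hs1 : 1 ≤ s := by rw [hs, one_le_div hD]; linarith
  have hs0 : 0 < s := by linarith
  have hα0 : 0 < α := by linarith
  have hs1' : 1 ≤ s' := by rw [hs', one_le_div (by linarith)]; linarith
  have hconj : ρ.HolderConjugate s' := Real.HolderConjugate.conjExponent hρ
  have hrel : s'⁻¹ = s⁻¹ - (n : ℝ)⁻¹ := by
    have : ρ - 1 ≠ 0 := by linarith
    rw [hs, hs']; field_simp; ring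
  obtain ⟨C, hC⟩ := exists_eLpNorm_sub_le_weakGradient hn (s := s.toNNReal) (s' := s'.toNNReal)
    (by rw [← Real.toNNReal_one]; exact Real.toNNReal_le_toNNReal hs1)
    (by rw [← Real.toNNReal_one]; exact Real.toNNReal_le_toNNReal hs1')
    (by rw [Real.coe_toNNReal _ (by linarith), Real.coe_toNNReal _ hs0.le, hrel])
  set v := volume (Metric.ball (0 : Rn n) 1) with hv
  have hvt : v ≠ ⊤ := measure_ball_lt_top.ne
  have hv1t : v ^ (1 / s) ≠ ⊤ := ENNReal.rpow_ne_top_of_nonneg (by positivity) hvt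
  refine ⟨C * (v ^ (1 / s)).toNNReal * (2 ^ (n / ρ) * 6 ^ (n / s) : ℝ).toNNReal,
    fun Ω hΩ f G hfG x a ha => ?_⟩
  -- For `y` in the annulus, `x - y` lies in `B(x, 2a)`; Sobolev–Poincaré triples this radius to
  -- `6a`.
  obtain ⟨c, hc⟩ := hC f G hfG x (2 * a) (by linarith)
  refine ⟨c, ?_⟩
  have h6 : 3 * (2 * a) = 6 * a := by ring
  rw [h6] at hc
  have hKm := aestronglyMeasurable_roughKernel hn hΩ
  have hfm : AEStronglyMeasurable (fun y => f (x - y)) volume :=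
    hfG.locallyIntegrable.aestronglyMeasurable.comp_quasiMeasurePreserving
      (quasiMeasurePreserving_sub_left volume x)
  have hholder := ENNReal.lintegral_mul_le_Lp_mul_Lq (volume.restrict (annulus n a)) hconj
    (f := fun y => ‖roughKernel Ω y‖ₑ) (g := fun y => ‖f (x - y) - c‖ₑ)
    hKm.enorm.restrict (hfm.sub aestronglyMeasurable_const).enorm.restrict
  have h1 : (∫⁻ y in annulus n a, ‖roughKernel Ω y‖ₑ ^ ρ) ^ (1 / ρ) ≤
      ENNReal.ofReal a⁻¹ ^ (n : ℝ) * ENNReal.ofReal (2 * a) ^ (n / ρ) *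
        eLpNorm Ω (ENNReal.ofReal ρ) (surfaceMeasure n) := by
    refine (ENNReal.rpow_le_rpow (lintegral_roughKernel_rpow_le hn hΩ hρ0.le ha)
      (by positivity)).trans (le_of_eq ?_)
    rw [ENNReal.mul_rpow_of_nonneg _ _ (by positivity), ENNReal.mul_rpow_of_nonneg _ _ (by positivity),
      ← ENNReal.rpow_mul, ← ENNReal.rpow_mul,
      eLpNorm_eq_lintegral_rpow_enorm_toReal (by simpa using hρ0) ENNReal.ofReal_ne_top,
      ENNReal.toReal_ofReal hρ0.le, mul_assoc (n : ℝ), mul_one_div_cancel hρ0.ne', mul_one,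
      mul_one_div]
  have h2 : (∫⁻ y in annulus n a, ‖f (x - y) - c‖ₑ ^ s') ^ (1 / s') ≤
      C * eLpNorm G (ENNReal.ofReal s) (volume.restrict (Metric.ball x (6 * a))) := by
    refine le_trans ?_ hc
    change _ ≤ eLpNorm _ (ENNReal.ofReal s') _
    rw [eLpNorm_eq_lintegral_rpow_enorm_toReal (by simp; linarith) ENNReal.ofReal_ne_top,
      ENNReal.toReal_ofReal (by linarith)]
    refine ENNReal.rpow_le_rpow ?_ (by positivity)
    rw [← lintegral_indicator (measurableSet_annulus a),
      ← lintegral_indicator Metric.isOpen_ball.measurableSet,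
      ← lintegral_sub_left_eq_self (μ := (volume : Measure (Rn n)))
        ((Metric.ball x (2 * a)).indicator fun z => ‖f z - c‖ₑ ^ s') x]
    refine lintegral_mono fun y => ?_
    by_cases hy : y ∈ annulus n a
    · have hxy : x - y ∈ Metric.ball x (2 * a) := by
        rw [mem_ball_iff_norm]; simpa using hy.2
      rw [indicator_of_mem hy, indicator_of_mem hxy]
    · rw [indicator_of_notMem hy]; exact zero_le
  set B := Metric.ball x (6 * a) with hB
  have hB0 : volume B ≠ 0 := (Metric.measure_ball_pos _ _ (by linarith)).ne'
  have hBt : volume B ≠ ⊤ := measure_ball_lt_top.ne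
  have h3 : eLpNorm G (ENNReal.ofReal s) (volume.restrict B) ≤
      volume B ^ (1 / s) * (⨍⁻ z in B, ‖G z‖ₑ ^ α ∂volume) ^ (1 / α) := by
    refine (eLpNorm_le_eLpNorm_mul_rpow_measure_univ (ENNReal.ofReal_le_ofReal hα)
      hfG.locallyIntegrable_grad.aestronglyMeasurable.restrict).trans (le_of_eq ?_)
    rw [eLpNorm_eq_lintegral_rpow_enorm_toReal (by simpa using hα0) ENNReal.ofReal_ne_top,
      ENNReal.toReal_ofReal hα0.le, ENNReal.toReal_ofReal hs0.le, Measure.restrict_apply_univ,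
      ← measure_mul_setLAverage _ hBt, ENNReal.mul_rpow_of_nonneg _ _ (by positivity),
      ENNReal.rpow_sub _ _ hB0 hBt, mul_right_comm, ENNReal.mul_div_cancel
        (ENNReal.rpow_pos (pos_iff_ne_zero.2 hB0) hBt).ne'
        (ENNReal.rpow_ne_top_of_nonneg (by positivity) hBt)]
  -- Scaling check: `-n + n/ρ + n/s = 1`, so one factor `a` survives.
  have hpow : ENNReal.ofReal a⁻¹ ^ (n : ℝ) * ENNReal.ofReal (2 * a) ^ (n / ρ) *
      ENNReal.ofReal (6 * a) ^ (n / s) =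
      ENNReal.ofReal (2 ^ (n / ρ) * 6 ^ (n / s)) * ENNReal.ofReal a := by
    rw [ENNReal.ofReal_rpow_of_pos (by positivity), ENNReal.ofReal_rpow_of_pos (by positivity),
      ENNReal.ofReal_rpow_of_pos (by positivity), ← ENNReal.ofReal_mul (by positivity),
      ← ENNReal.ofReal_mul (by positivity), ← ENNReal.ofReal_mul (by positivity)]
    congr 1
    rw [Real.mul_rpow (by norm_num) ha.le, Real.mul_rpow (by norm_num) ha.le,
      Real.inv_rpow ha.le, ← Real.rpow_neg ha.le]
    have h5 : a ^ (-(n : ℝ)) * a ^ (n / ρ) * a ^ (n / s) = a := by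
      rw [← Real.rpow_add ha, ← Real.rpow_add ha]
      have : -(n : ℝ) + n / ρ + n / s = 1 := by
        rw [hs]; field_simp; ring
      rw [this, Real.rpow_one]
    calc _ = 2 ^ (n / ρ) * 6 ^ (n / s) * (a ^ (-(n : ℝ)) * a ^ (n / ρ) * a ^ (n / s)) := by ring
      _ = _ := by rw [h5]
  have hvol : volume B ^ (1 / s) = ENNReal.ofReal (6 * a) ^ (n / s) * v ^ (1 / s) := by
    rw [hB, volume_ball_eq hn x (by linarith : 0 < 6 * a),
      ENNReal.mul_rpow_of_nonneg _ _ (by positivity), ← ENNReal.rpow_mul, mul_one_div]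
  rw [hvol] at h3
  set P := (⨍⁻ z in B, ‖G z‖ₑ ^ α ∂volume) ^ (1 / α)
  calc _ ≤ _ := hholder
    _ ≤ (ENNReal.ofReal a⁻¹ ^ (n : ℝ) * ENNReal.ofReal (2 * a) ^ (n / ρ) *
        eLpNorm Ω (ENNReal.ofReal ρ) (surfaceMeasure n)) *
        (C * (ENNReal.ofReal (6 * a) ^ (n / s) * v ^ (1 / s) * P)) :=
        mul_le_mul' h1 (h2.trans (mul_le_mul_right h3 _))
    _ = C * v ^ (1 / s) * eLpNorm Ω (ENNReal.ofReal ρ) (surfaceMeasure n) *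
        (ENNReal.ofReal a⁻¹ ^ (n : ℝ) * ENNReal.ofReal (2 * a) ^ (n / ρ) *
          ENNReal.ofReal (6 * a) ^ (n / s)) * P := by ring
    _ = _ := by
        rw [hpow]
        push_cast
        rw [ENNReal.coe_toNNReal hv1t]
        simp only [ENNReal.ofReal]
        ring

/-- Cancellation on a single annulus. -/
theorem integrableOn_annulus_and_enorm_setIntegral_le (hn : 0 < n) {ρ : ℝ} (hρ : 1 < ρ)
    {Ω : UnitSphere n → ℝ} (hΩ : MemLp Ω (ENNReal.ofReal ρ) (surfaceMeasure n))
    (hΩ0 : ∫ θ, Ω θ ∂(surfaceMeasure n) = 0) {f : Rn n → ℝ} (hf : LocallyIntegrable f volume)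
    {x : Rn n} {a c : ℝ} (ha : 0 < a) {b : ℝ≥0∞} (hb : b ≠ ⊤)
    (h : ∫⁻ y in annulus n a, ‖roughKernel Ω y‖ₑ * ‖f (x - y) - c‖ₑ ≤ b) :
    IntegrableOn (fun y => roughKernel Ω y * f (x - y)) (annulus n a) ∧
    ∀ I : Set ℝ, MeasurableSet I →
      ‖∫ y in annulus n a ∩ {y | ‖y‖ ∈ I}, roughKernel Ω y * f (x - y)‖ₑ ≤ b := by
  have hρ0 : 0 < ρ := by linarith
  have hKm := aestronglyMeasurable_roughKernel hn hΩ.aestronglyMeasurable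
  have hfm : AEStronglyMeasurable (fun y => f (x - y)) volume :=
    hf.aestronglyMeasurable.comp_quasiMeasurePreserving (quasiMeasurePreserving_sub_left volume x)
  have hfin : IsFiniteMeasure (volume.restrict (annulus n a)) :=
    ⟨by rw [Measure.restrict_apply_univ]; exact volume_annulus_lt_top a⟩
  -- The kernel is in `L^ρ` of a set of finite measure, hence integrable, so the term with the
  -- constant `c` can be split off.
  have hKI : IntegrableOn (roughKernel Ω) (annulus n a) := by
    have hmem : MemLp (roughKernel Ω) (ENNReal.ofReal ρ) (volume.restrict (annulus n a)) := by
      refine ⟨hKm.restrict, ?_⟩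
      rw [eLpNorm_lt_top_iff_lintegral_rpow_enorm_lt_top (by simpa using hρ0) ENNReal.ofReal_ne_top,
        ENNReal.toReal_ofReal hρ0.le]
      refine (lintegral_roughKernel_rpow_le hn hΩ.aestronglyMeasurable hρ0.le ha).trans_lt ?_
      have h2 := lintegral_rpow_enorm_lt_top_of_eLpNorm_lt_top (by simpa using hρ0)
        ENNReal.ofReal_ne_top hΩ.eLpNorm_lt_top
      rw [ENNReal.toReal_ofReal hρ0.le] at h2
      exact ENNReal.mul_lt_top (ENNReal.mul_lt_top
        (ENNReal.rpow_lt_top_of_nonneg (by positivity) ENNReal.ofReal_ne_top)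
        (ENNReal.rpow_lt_top_of_nonneg (by positivity) ENNReal.ofReal_ne_top)) h2
    exact hmem.integrable (by rw [ENNReal.one_le_ofReal]; exact hρ.le)
  have hKfI : IntegrableOn (fun y => roughKernel Ω y * (f (x - y) - c)) (annulus n a) := by
    refine ⟨(hKm.mul (hfm.sub aestronglyMeasurable_const)).restrict, ?_⟩
    simp only [HasFiniteIntegral, enorm_mul]
    exact h.trans_lt hb.lt_top
  have hdecomp : (fun y => roughKernel Ω y * f (x - y)) =
      fun y => roughKernel Ω y * (f (x - y) - c) + c * roughKernel Ω y := by
    ext y; ring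
  refine ⟨?_, fun I hI => ?_⟩
  · rw [hdecomp]
    exact hKfI.add (hKI.const_mul c)
  · have hset : annulus n a ∩ {y : Rn n | ‖y‖ ∈ I} = {y | ‖y‖ ∈ Ico a (2 * a) ∩ I} := rfl
    have hz : ∫ y in annulus n a ∩ {y : Rn n | ‖y‖ ∈ I}, roughKernel Ω y = 0 := by
      rw [hset]
      exact setIntegral_roughKernel_eq_zero hn hΩ0 (measurableSet_Ico.inter hI)
    rw [hdecomp, integral_add (hKfI.mono_set inter_subset_left)
      ((hKI.mono_set inter_subset_left).const_mul c), integral_const_mul, hz, mul_zero, add_zero]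
    refine (enorm_integral_le_lintegral_enorm _).trans (le_trans ?_ h)
    simp only [enorm_mul]
    exact lintegral_mono_set inter_subset_left

/-- Convergence of the truncated integrals from dyadic bounds. -/
theorem exists_hasPrincipalValue {Ω : UnitSphere n → ℝ} {f : Rn n → ℝ} {x : Rn n}
    {b : ℤ → ℝ≥0∞} (hb : ∑' k, b k ≠ ⊤)
    (h : ∀ k : ℤ, IntegrableOn (fun y => roughKernel Ω y * f (x - y)) (annulus n (2 ^ k)) ∧
      ∀ I : Set ℝ, MeasurableSet I →
        ‖∫ y in annulus n (2 ^ k) ∩ {y | ‖y‖ ∈ I}, roughKernel Ω y * f (x - y)‖ₑ ≤ b k) :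
    ∃ L : ℝ, HasPrincipalValue Ω f x L ∧ ‖L‖ₑ ≤ ∑' k, b k := by
  set F : Rn n → ℝ := fun y => roughKernel Ω y * f (x - y) with hF
  set A : ℤ → Set (Rn n) := fun k => annulus n (2 ^ k) with hA
  have hmemA : ∀ (k : ℤ) (y : Rn n), y ∈ A k ↔ ‖y‖ ∈ Ico ((2 : ℝ) ^ k) (2 ^ (k + 1)) := by
    intro k y
    simp only [hA, annulus, mem_ofPred_eq, mem_Ico, zpow_add_one₀ (two_ne_zero' ℝ), mul_comm]
  have hdisj : ∀ k l : ℤ, k < l → Disjoint (A k) (A l) := by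
    intro k l hkl
    rw [Set.disjoint_left]
    intro y hy hy'
    rw [hmemA] at hy hy'
    have : (2 : ℝ) ^ (k + 1) ≤ 2 ^ l := zpow_le_zpow_right₀ (by norm_num) (by omega)
    linarith [hy.2, hy'.1]
  have hbk : ∀ k, b k ≠ ⊤ := fun k => ENNReal.ne_top_of_tsum_ne_top hb k
  set E : ℝ × ℝ → Set (Rn n) := fun t => {y : Rn n | t.1 < ‖y‖ ∧ ‖y‖ < t.2} with hE
  have hEI : ∀ t, E t = {y : Rn n | ‖y‖ ∈ Ioo t.1 t.2} := fun t => rfl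
  have hEm : ∀ t, MeasurableSet (E t) := fun t => measurable_norm measurableSet_Ioo
  have hcover : ∀ t : ℝ × ℝ, 0 < t.1 → E t = ⋃ k, A k ∩ E t := by
    intro t ht
    ext y
    simp only [mem_iUnion, mem_inter_iff]
    constructor
    · intro hy
      obtain ⟨k, hk⟩ := exists_mem_Ico_zpow (ht.trans hy.1) (by norm_num : (1 : ℝ) < 2)
      exact ⟨k, (hmemA k y).2 hk, hy⟩
    · rintro ⟨k, -, hy⟩; exact hy
  have hint : ∀ t : ℝ × ℝ, 0 < t.1 → IntegrableOn F (E t) := by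
    intro t ht
    rcases le_or_gt t.2 0 with h2 | h2
    · have : E t = ∅ := by
        ext y
        simp only [hE, mem_ofPred_eq, mem_empty_iff_false, iff_false, not_and]
        intro h3 h4
        linarith
      rw [this]; exact integrableOn_empty
    obtain ⟨k₁, hk₁⟩ := exists_mem_Ico_zpow ht (by norm_num : (1 : ℝ) < 2)
    obtain ⟨k₂, hk₂⟩ := exists_mem_Ico_zpow h2 (by norm_num : (1 : ℝ) < 2)
    have hsub : E t ⊆ ⋃ k ∈ Finset.Icc k₁ k₂, A k := by
      intro y hy
      obtain ⟨k, hk⟩ := exists_mem_Ico_zpow (ht.trans hy.1) (by norm_num : (1 : ℝ) < 2)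
      have h3 : k₁ < k + 1 := (zpow_lt_zpow_iff_right₀ (by norm_num : (1:ℝ) < 2)).1
        (hk₁.1.trans_lt (hy.1.trans hk.2))
      have h4 : k < k₂ + 1 := (zpow_lt_zpow_iff_right₀ (by norm_num : (1:ℝ) < 2)).1
        (hk.1.trans_lt (hy.2.trans hk₂.2))
      exact mem_biUnion (Finset.mem_coe.2 (Finset.mem_Icc.2 ⟨by omega, by omega⟩)) ((hmemA k y).2 hk)
    exact (integrableOn_finset_iUnion.2 fun k _ => (h k).1).mono_set hsub
  have hsum : ∀ t : ℝ × ℝ, 0 < t.1 →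
      truncatedRough Ω f x t.1 t.2 = ∑' k, ∫ y in A k ∩ E t, F y := by
    intro t ht
    rw [← integral_iUnion]
    · rw [← hcover t ht]; rfl
    · exact fun k => (measurableSet_annulus _).inter (hEm t)
    · intro k l hkl
      rcases lt_or_gt_of_ne hkl with h1 | h1
      · exact (hdisj k l h1).mono inter_subset_left inter_subset_left
      · exact (hdisj l k h1).symm.mono inter_subset_left inter_subset_left
    · rw [← hcover t ht]; exact hint t ht
  have hpos : ∀ᶠ t : ℝ × ℝ in 𝓝[>] (0 : ℝ) ×ˢ atTop, 0 < t.1 :=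
    (tendsto_fst.eventually (eventually_mem_nhdsWithin (a := (0 : ℝ)) (s := Ioi 0)))
  -- A truncated annulus is again a radial set, so `b k` dominates uniformly in the truncation.
  have hterm : ∀ (k : ℤ) (t : ℝ × ℝ), ‖∫ y in A k ∩ E t, F y‖ₑ ≤ b k := fun k t =>
    (h k).2 (Ioo t.1 t.2) measurableSet_Ioo
  -- Each term is eventually constant: once `ε < 2^k` and `R > 2^(k+1)`, the whole annulus is inside
  -- the truncation.
  have hlim : ∀ k : ℤ, Tendsto (fun t : ℝ × ℝ => ∫ y in A k ∩ E t, F y)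
      (𝓝[>] (0 : ℝ) ×ˢ atTop) (𝓝 (∫ y in A k, F y)) := by
    intro k
    refine tendsto_const_nhds.congr' ?_
    have h1 : ∀ᶠ t : ℝ × ℝ in 𝓝[>] (0 : ℝ) ×ˢ atTop, t.1 < 2 ^ k :=
      tendsto_fst.eventually (nhdsWithin_le_nhds (eventually_lt_nhds (by positivity)))
    have h2 : ∀ᶠ t : ℝ × ℝ in 𝓝[>] (0 : ℝ) ×ˢ atTop, 2 ^ (k + 1) < t.2 :=
      tendsto_snd.eventually (eventually_gt_atTop _)
    filter_upwards [h1, h2] with t ht1 ht2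
    rw [inter_eq_left.2]
    intro y hy
    rw [hmemA] at hy
    exact ⟨ht1.trans_le hy.1, hy.2.trans ht2⟩
  have hbs : Summable fun k => (b k).toReal := ENNReal.summable_toReal hb
  have hnorm : ∀ {r : ℝ} {k : ℤ}, ‖r‖ₑ ≤ b k → ‖r‖ ≤ (b k).toReal := by
    intro r k hr
    rw [← toReal_enorm]
    exact ENNReal.toReal_mono (hbk k) hr
  have htend := tendsto_tsum_of_dominated_convergence hbs hlim
    (Eventually.of_forall fun t k => hnorm (hterm k t))
  refine ⟨∑' k, ∫ y in A k, F y, ⟨fun ε R hε => hint (ε, R) hε, ?_⟩, ?_⟩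
  · refine htend.congr' ?_
    filter_upwards [hpos] with t ht
    rw [hsum t ht]
  · have hA' : ∀ k, ‖∫ y in A k, F y‖ₑ ≤ b k := fun k => by
      have := (h k).2 univ MeasurableSet.univ
      simpa using this
    have h3 : ‖∑' k, ∫ y in A k, F y‖ ≤ ∑' k, (b k).toReal :=
      tsum_of_norm_bounded hbs.hasSum fun k => hnorm (hA' k)
    rw [← ofReal_norm]
    refine (ENNReal.ofReal_le_ofReal h3).trans (le_of_eq ?_)
    rw [← ENNReal.tsum_toReal_eq hbk, ENNReal.ofReal_toReal hb]

/-- Hedberg's inequality, with the Morrey norm controlling the large scales. -/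
theorem tsum_setLAverage_le (hn : 0 < n) {α β : ℝ} (hα : 0 < α) (hαβ : α < β) :
    ∃ C : ℝ≥0, ∀ (G : Rn n → Rn n), morreyNorm α (α * n / β) G ≠ ⊤ → ∀ x,
      maximalFunction volume (fun z => ‖G z‖ₑ ^ α) x ≠ ⊤ →
      ∑' k : ℤ, ENNReal.ofReal (2 ^ k) *
        (⨍⁻ z in Metric.ball x (6 * 2 ^ k), ‖G z‖ₑ ^ α ∂volume) ^ (1 / α) ≤
      C * morreyNorm α (α * n / β) G ^ (α / β) *
        (maximalFunction volume (fun z => ‖G z‖ₑ ^ α) x ^ (1 / α)) ^ (1 - α / β) := by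
  have hβ : 0 < β := hα.trans hαβ
  have hnr : (0 : ℝ) < n := by exact_mod_cast hn
  -- The Morrey bound on the average decays like `r^(-β)`; its `1/α` power times `2^k` is `2^(-kγ)`,
  -- and `1/(1+γ) = α/β`.
  set γ := β / α - 1 with hγ
  have hγ0 : 0 < γ := by rw [hγ, sub_pos, one_lt_div hα]; exact hαβ
  have hθ : 1 / (1 + γ) = α / β := by rw [hγ, add_sub_cancel, one_div_div]
  obtain ⟨C, hC⟩ := tsum_min_zpow_le hγ0
  rw [hθ] at hC
  set v := volume (Metric.ball (0 : Rn n) 1) with hv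
  have hv0 : v ≠ 0 := (Metric.measure_ball_pos _ _ one_pos).ne'
  have hvt : v ≠ ⊤ := measure_ball_lt_top.ne
  set V := (v⁻¹) ^ (1 / α) with hV
  have hVt : V ≠ ⊤ := ENNReal.rpow_ne_top_of_nonneg (by positivity) (ENNReal.inv_ne_top.2 hv0)
  refine ⟨C * (V ^ (α / β)).toNNReal, fun G hN x hM => ?_⟩
  set N := morreyNorm α (α * n / β) G with hNdef
  set M := maximalFunction volume (fun z => ‖G z‖ₑ ^ α) x with hMdef
  have hterm : ∀ k : ℤ, ENNReal.ofReal (2 ^ k) *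
        (⨍⁻ z in Metric.ball x (6 * 2 ^ k), ‖G z‖ₑ ^ α ∂volume) ^ (1 / α) ≤
      min ((2 : ℝ≥0∞) ^ k * M ^ (1 / α)) (((2 : ℝ≥0∞) ^ k) ^ (-γ) * (V * N)) := by
    intro k
    have h2k : (0 : ℝ) < 2 ^ k := by positivity
    have hcast : ENNReal.ofReal (2 ^ k) = (2 : ℝ≥0∞) ^ k := by
      rw [← Real.rpow_intCast, ← ENNReal.rpow_intCast, ← ENNReal.ofReal_rpow_of_pos (by norm_num)]
      simp
    have h6 : 0 < 6 * (2 : ℝ) ^ k := by positivity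
    refine le_min ?_ ?_
    · rw [hcast]
      gcongr
      exact setLAverage_le_maximalFunction _ _ (Metric.mem_ball_self h6)
    · set r : ℝ := 6 * 2 ^ k with hr
      set J := ∫⁻ z in Metric.ball x r, ‖G z‖ₑ ^ α with hJ
      have hmor : (ENNReal.ofReal (r ^ (-(n - β))) * J) ^ (1 / α) ≤ N := by
        have h1 : (n : ℝ) * (1 - α / (α * n / β)) = n - β := by field_simp
        have h2 : (ENNReal.ofReal (r ^ (-((n : ℝ) * (1 - α / (α * n / β))))) * J) ^ (1 / α) ≤ N :=
          le_iSup_of_le x (le_iSup_of_le r (le_iSup_of_le h6 le_rfl))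
        rwa [h1] at h2
      have havg : ⨍⁻ z in Metric.ball x r, ‖G z‖ₑ ^ α ∂volume =
          v⁻¹ * (ENNReal.ofReal (r ^ (-β)) * (ENNReal.ofReal (r ^ (-(n - β))) * J)) := by
        rw [setLAverage_eq, volume_ball_eq hn x h6, ENNReal.ofReal_rpow_of_pos h6, div_eq_mul_inv,
          ENNReal.mul_inv (Or.inr hvt) (Or.inr hv0), ← ENNReal.ofReal_inv_of_pos (by positivity),
          ← mul_assoc (ENNReal.ofReal _) (ENNReal.ofReal _) J, ← ENNReal.ofReal_mul (by positivity),
          ← Real.rpow_add h6, ← Real.rpow_neg h6.le]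
        have : -β + -(n - β) = -(n : ℝ) := by ring
        rw [this]; ring
      rw [havg, ENNReal.mul_rpow_of_nonneg _ _ (by positivity),
        ENNReal.mul_rpow_of_nonneg _ _ (by positivity), ENNReal.ofReal_rpow_of_pos (by positivity),
        ← Real.rpow_mul h6.le]
      calc ENNReal.ofReal (2 ^ k) * (V * (ENNReal.ofReal (r ^ (-β * (1 / α))) *
            (ENNReal.ofReal (r ^ (-(n - β))) * J) ^ (1 / α)))
          ≤ ENNReal.ofReal (2 ^ k) * (V * (ENNReal.ofReal (r ^ (-β * (1 / α))) * N)) := by gcongr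
        _ = ENNReal.ofReal (2 ^ k * r ^ (-β * (1 / α))) * (V * N) := by
            rw [ENNReal.ofReal_mul h2k.le]; ring
        _ ≤ ((2 : ℝ≥0∞) ^ k) ^ (-γ) * (V * N) := by
            gcongr
            rw [← hcast, ENNReal.ofReal_rpow_of_pos h2k]
            refine ENNReal.ofReal_le_ofReal ?_
            have h7 : -γ = 1 + -β * (1 / α) := by rw [hγ]; ring
            rw [h7, Real.rpow_add h2k, Real.rpow_one]
            refine mul_le_mul_of_nonneg_left ?_ h2k.le
            -- The exponent is negative, so the factor 6 in the radius can be dropped.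
            refine Real.rpow_le_rpow_of_nonpos h2k (by rw [hr]; linarith) ?_
            have : 0 < β * (1 / α) := by positivity
            linarith
  refine (ENNReal.tsum_le_tsum hterm).trans ((hC _ _ ?_ ?_).trans (le_of_eq ?_))
  · exact ENNReal.rpow_ne_top_of_nonneg (by positivity) hM
  · exact ENNReal.mul_ne_top hVt hN
  · rw [ENNReal.mul_rpow_of_nonneg _ _ (by positivity)]
    push_cast
    rw [ENNReal.coe_toNNReal (ENNReal.rpow_ne_top_of_nonneg (by positivity) hVt)]
    ring

end Annuli

/-! ### Measurability of the operator and the main estimate. -/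

section MainTheorem

variable {n : ℕ}

theorem aestronglyMeasurable_truncatedRough (hn : 0 < n) {Ω : UnitSphere n → ℝ}
    (hΩ : AEStronglyMeasurable Ω (surfaceMeasure n)) {f : Rn n → ℝ}
    (hf : AEStronglyMeasurable f volume) (ε R : ℝ) :
    AEStronglyMeasurable (fun x => truncatedRough Ω f x ε R) volume := by
  have hK := aestronglyMeasurable_roughKernel hn hΩ
  set K' := hK.mk
  set f' := hf.mk
  have heq : ∀ x, truncatedRough Ω f x ε R =
      ∫ y in {y : Rn n | ε < ‖y‖ ∧ ‖y‖ < R}, K' y * f' (x - y) := by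
    intro x
    refine integral_congr_ae (ae_restrict_of_ae ?_)
    filter_upwards [hK.ae_eq_mk, (quasiMeasurePreserving_sub_left volume x).ae hf.ae_eq_mk]
      with y h1 h2
    rw [h1, h2]
  simp_rw [heq]
  have hm : StronglyMeasurable fun q : Rn n × Rn n => K' q.2 * f' (q.1 - q.2) :=
    (hK.stronglyMeasurable_mk.comp_measurable measurable_snd).mul
      (hf.stronglyMeasurable_mk.comp_measurable (by fun_prop))
  exact hm.integral_prod_right'.aestronglyMeasurable

theorem HasPrincipalValue.roughSingularIntegral_eq {Ω : UnitSphere n → ℝ} {f : Rn n → ℝ}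
    {x : Rn n} {L : ℝ} (h : HasPrincipalValue Ω f x L) : roughSingularIntegral Ω f x = L :=
  h.2.limUnder_eq

/-- An almost everywhere limit of measurable truncations along the sequence `ε = 1/(j+1)`, `R = j`.
-/
theorem aestronglyMeasurable_roughSingularIntegral (hn : 0 < n) {Ω : UnitSphere n → ℝ}
    (hΩ : AEStronglyMeasurable Ω (surfaceMeasure n)) {f : Rn n → ℝ}
    (hf : AEStronglyMeasurable f volume)
    (h : ∀ᵐ x, HasPrincipalValue Ω f x (roughSingularIntegral Ω f x)) :
    AEStronglyMeasurable (roughSingularIntegral Ω f) volume := by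
  have hseq : Tendsto (fun j : ℕ => ((1 : ℝ) / ((j : ℝ) + 1), (j : ℝ))) atTop
      (𝓝[>] (0 : ℝ) ×ˢ atTop) := by
    refine Tendsto.prodMk ?_ tendsto_natCast_atTop_atTop
    refine tendsto_nhdsWithin_iff.2 ⟨tendsto_one_div_add_atTop_nhds_zero_nat, ?_⟩
    exact Eventually.of_forall fun j => by rw [mem_Ioi]; positivity
  refine aestronglyMeasurable_of_tendsto_ae atTop
    (f := fun (j : ℕ) x => truncatedRough Ω f x (1 / ((j : ℝ) + 1)) j)
    (fun j => aestronglyMeasurable_truncatedRough hn hΩ hf _ _) ?_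
  filter_upwards [h] with x hx
  exact hx.2.comp hseq

end MainTheorem

end RoughSingular

open RoughSingular in
theorem mainTheorem3 (n : ℕ) (hn : 2 ≤ n) (ρ α β p q : ℝ)
    (hρ : 1 < ρ) (hρn : ρ < n)
    (hα : ρ * n / (ρ * n + ρ - n) ≤ α) (hα1 : 1 < α) (hαβ : α < β) (hβn : β < n)
    (hαp : α < p) (hq : q = p / (1 - α / β))
    (w : RoughSingular.Rn n → ℝ) (hw : RoughSingular.IsMuckenhouptWeight (p / α) w) :
    ∃ C : ℝ≥0, ∀ Ω : RoughSingular.UnitSphere n → ℝ,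
      Integrable Ω (RoughSingular.surfaceMeasure n) →
      ∫ θ, Ω θ ∂(RoughSingular.surfaceMeasure n) = 0 →
      MemLp Ω (ENNReal.ofReal ρ) (RoughSingular.surfaceMeasure n) →
      ∀ (f : RoughSingular.Rn n → ℝ) (G : RoughSingular.Rn n → RoughSingular.Rn n),
        RoughSingular.IsWeakGradient f G →
        RoughSingular.MemMorrey α (α * n / β) G →
        MemLp G (ENNReal.ofReal p) (RoughSingular.weightedMeasure w) →
        (∀ᵐ x, RoughSingular.HasPrincipalValue Ω f x
          (RoughSingular.roughSingularIntegral Ω f x)) ∧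
        MemLp (RoughSingular.roughSingularIntegral Ω f) (ENNReal.ofReal q)
          (RoughSingular.weightedMeasure w) ∧
        eLpNorm (RoughSingular.roughSingularIntegral Ω f) (ENNReal.ofReal q)
            (RoughSingular.weightedMeasure w) ≤
          C * eLpNorm Ω (ENNReal.ofReal ρ) (RoughSingular.surfaceMeasure n) *
            RoughSingular.morreyNorm α (α * n / β) G ^ (α / β) *
            eLpNorm G (ENNReal.ofReal p) (RoughSingular.weightedMeasure w) ^ (1 - α / β) := by
  have hn0 : 0 < n := by omega
  have hα0 : 0 < α := by linarith
  have hβ0 : 0 < β := by linarith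
  have hp0 : 0 < p := by linarith
  have hθ1 : α / β < 1 := (div_lt_one hβ0).2 hαβ
  have hθ0 : 0 < 1 - α / β := by linarith
  have hq0 : 0 < q := by rw [hq]; positivity
  have hpα : 1 < p / α := (one_lt_div hα0).2 hαp
  obtain ⟨C₁, hC₁⟩ := exists_lintegral_annulus_le hn0 hρ hρn hα
  obtain ⟨C₂, hC₂⟩ := tsum_setLAverage_le (n := n) hn0 hα0 hαβ
  obtain ⟨C₃, hC₃⟩ := hw.lintegral_maximalFunction_rpow_le hpα
  refine ⟨C₁ * C₂ * C₃ ^ (1 / q), fun Ω _ hΩ0 hΩ f G hfG hmor hG => ?_⟩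
  set O := eLpNorm Ω (ENNReal.ofReal ρ) (surfaceMeasure n) with hO
  set N := morreyNorm α (α * n / β) G with hN
  set μw := weightedMeasure w with hμw
  have hOt : O ≠ ⊤ := hΩ.eLpNorm_ne_top
  have hNt : N ≠ ⊤ := hmor.2.ne
  have hGm : AEMeasurable (fun z => ‖G z‖ₑ ^ α) volume :=
    hfG.locallyIntegrable_grad.aestronglyMeasurable.enorm.pow_const _
  have hμv : μw ≪ volume := withDensity_absolutelyContinuous _ _
  set M := maximalFunction volume (fun z => ‖G z‖ₑ ^ α) with hM
  have hMm : Measurable M := measurable_maximalFunction _ _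
  have hGp : eLpNorm G (ENNReal.ofReal p) μw = (∫⁻ x, ‖G x‖ₑ ^ p ∂μw) ^ (1 / p) := by
    rw [eLpNorm_eq_lintegral_rpow_enorm_toReal (by simpa using hp0) ENNReal.ofReal_ne_top,
      ENNReal.toReal_ofReal hp0.le]
  have hmax : ∫⁻ x, M x ^ (p / α) ∂μw ≤ C₃ * ∫⁻ x, ‖G x‖ₑ ^ p ∂μw := by
    refine (hC₃ _ hGm).trans (le_of_eq ?_)
    congr 1
    refine lintegral_congr fun x => ?_
    rw [← ENNReal.rpow_mul, mul_div_cancel₀ _ hα0.ne']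
  have hGfin : ∫⁻ x, ‖G x‖ₑ ^ p ∂μw < ⊤ := by
    have := lintegral_rpow_enorm_lt_top_of_eLpNorm_lt_top (by simpa using hp0)
      ENNReal.ofReal_ne_top hG.eLpNorm_lt_top
    rwa [ENNReal.toReal_ofReal hp0.le] at this
  -- Finiteness holds first almost everywhere for `w dx`, and then for Lebesgue measure because `w >
  -- 0` almost everywhere.
  have hMfin : ∀ᵐ x, M x ≠ ⊤ := by
    have h1 : ∀ᵐ x ∂μw, M x ^ (p / α) < ⊤ :=
      ae_lt_top (hMm.pow_const _) (hmax.trans_lt (ENNReal.mul_lt_top ENNReal.coe_lt_top hGfin)).ne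
    rw [hμw, weightedMeasure, ae_withDensity_iff'
      hw.locallyIntegrable.aestronglyMeasurable.aemeasurable.ennreal_ofReal] at h1
    filter_upwards [h1, hw.pos] with x hx hx0 htop
    have := hx (by simpa using hx0)
    rw [htop, ENNReal.top_rpow_of_pos (by positivity)] at this
    exact lt_irrefl _ this
  have hpv : ∀ᵐ x, HasPrincipalValue Ω f x (roughSingularIntegral Ω f x) ∧
      ‖roughSingularIntegral Ω f x‖ₑ ≤
        C₁ * O * (C₂ * N ^ (α / β) * (M x ^ (1 / α)) ^ (1 - α / β)) := by
    filter_upwards [hMfin] with x hx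
    set b : ℤ → ℝ≥0∞ := fun k => C₁ * O * (ENNReal.ofReal (2 ^ k) *
      (⨍⁻ z in Metric.ball x (6 * 2 ^ k), ‖G z‖ₑ ^ α ∂volume) ^ (1 / α)) with hb
    have hble : ∑' k, b k ≤ C₁ * O * (C₂ * N ^ (α / β) * (M x ^ (1 / α)) ^ (1 - α / β)) := by
      rw [hb, ENNReal.tsum_mul_left]
      exact mul_le_mul_right (hC₂ G hNt x hx) _
    have hbt : ∑' k, b k ≠ ⊤ := by
      refine (hble.trans_lt (ENNReal.mul_lt_top (ENNReal.mul_lt_top ENNReal.coe_lt_top hOt.lt_top)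
        (ENNReal.mul_lt_top (ENNReal.mul_lt_top ENNReal.coe_lt_top ?_) ?_))).ne
      · exact ENNReal.rpow_lt_top_of_nonneg (by positivity) hNt
      · exact ENNReal.rpow_lt_top_of_nonneg hθ0.le
          (ENNReal.rpow_ne_top_of_nonneg (by positivity) hx)
    obtain ⟨L, hL, hLle⟩ := exists_hasPrincipalValue (Ω := Ω) (f := f) (x := x) hbt fun k => by
      obtain ⟨c, hc⟩ := hC₁ Ω hΩ.aestronglyMeasurable f G hfG x (2 ^ k) (by positivity)
      exact integrableOn_annulus_and_enorm_setIntegral_le hn0 hρ hΩ hΩ0 hfG.locallyIntegrable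
        (by positivity) (ENNReal.ne_top_of_tsum_ne_top hbt k) hc
    rw [hL.roughSingularIntegral_eq]
    exact ⟨hL, hLle.trans hble⟩
  have hTm : AEStronglyMeasurable (roughSingularIntegral Ω f) μw :=
    (aestronglyMeasurable_roughSingularIntegral hn0 hΩ.aestronglyMeasurable
      hfG.locallyIntegrable.aestronglyMeasurable (hpv.mono fun x hx => hx.1)).mono_ac hμv
  have hbound : eLpNorm (roughSingularIntegral Ω f) (ENNReal.ofReal q) μw ≤
      (C₁ * C₂ * C₃ ^ (1 / q) : ℝ≥0) * O * N ^ (α / β) *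
        eLpNorm G (ENNReal.ofReal p) μw ^ (1 - α / β) := by
    -- The choice of `q` makes the `q`-th power of the pointwise bound contain exactly `M^(p/α)`.
    have hexp : 1 / α * ((1 - α / β) * q) = p / α := by
      rw [hq, mul_div_cancel₀ _ hθ0.ne', one_div_mul_eq_div]
    have hexp2 : 1 / p * (1 - α / β) = 1 / q := by
      rw [hq]; field_simp
    have hDt : C₁ * O * (C₂ * N ^ (α / β)) ≠ ⊤ :=
      ENNReal.mul_ne_top (ENNReal.mul_ne_top ENNReal.coe_ne_top hOt)
        (ENNReal.mul_ne_top ENNReal.coe_ne_top (ENNReal.rpow_ne_top_of_nonneg (by positivity) hNt))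
    rw [eLpNorm_eq_lintegral_rpow_enorm_toReal (by simpa using hq0) ENNReal.ofReal_ne_top,
      ENNReal.toReal_ofReal hq0.le, hGp, ← ENNReal.rpow_mul, hexp2]
    calc (∫⁻ x, ‖roughSingularIntegral Ω f x‖ₑ ^ q ∂μw) ^ (1 / q)
        ≤ (∫⁻ x, (C₁ * O * (C₂ * N ^ (α / β))) ^ q * M x ^ (p / α) ∂μw) ^ (1 / q) := by
          refine ENNReal.rpow_le_rpow (lintegral_mono_ae ?_) (by positivity)
          filter_upwards [hμv.ae_le hpv] with x hx
          refine (ENNReal.rpow_le_rpow hx.2 hq0.le).trans (le_of_eq ?_)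
          rw [← mul_assoc, ENNReal.mul_rpow_of_nonneg _ _ hq0.le, ← ENNReal.rpow_mul,
            ← ENNReal.rpow_mul, hexp]
      _ = C₁ * O * (C₂ * N ^ (α / β)) * (∫⁻ x, M x ^ (p / α) ∂μw) ^ (1 / q) := by
          rw [lintegral_const_mul' _ _ (ENNReal.rpow_ne_top_of_nonneg hq0.le hDt),
            ENNReal.mul_rpow_of_nonneg _ _ (by positivity), ← ENNReal.rpow_mul,
            mul_one_div_cancel hq0.ne', ENNReal.rpow_one]
      _ ≤ C₁ * O * (C₂ * N ^ (α / β)) * (C₃ * ∫⁻ x, ‖G x‖ₑ ^ p ∂μw) ^ (1 / q) := by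
          gcongr
      _ = _ := by
          rw [ENNReal.mul_rpow_of_nonneg _ _ (by positivity)]
          push_cast [ENNReal.coe_rpow_of_nonneg _ (by positivity : 0 ≤ 1 / q)]
          ring
  refine ⟨hpv.mono fun x hx => hx.1, ⟨hTm, hbound.trans_lt ?_⟩, hbound⟩
  exact ENNReal.mul_lt_top (ENNReal.mul_lt_top (ENNReal.mul_lt_top ENNReal.coe_lt_top hOt.lt_top)
    (ENNReal.rpow_lt_top_of_nonneg (by positivity) hNt))
    (ENNReal.rpow_lt_top_of_nonneg hθ0.le hG.eLpNorm_ne_top)
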